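/- Let $n\ge 1$, let $-\infty\le a<b\le\infty$, and let $A:(a,b)\to\mathbb{R}^{n\times n}$ be continuous. Use the following definitions. For a finite sequence $y=(y_1,\dots,y_m)$ of real numbers let $\sigma(y)$ be the number of indices $k\in\{1,\dots,m-1\}$ with $y_ky_{k+1}<0$, and let $s^-(y):=\sigma(\bar y)$, where $\bar y$ is obtained from $y$ by deleting all zero entries. For $y\in\mathbb{R}^n$ let $$s_c^-(y):=\max_{1\le i\le n}s^-(y_i,\dots,y_n,y_1,\dots,y_i),\qquad s_c^+(y):=\max_{z\in P(y)}\ \max_{1\le i\le n}\sigma(z_i,\dots,z_n,z_1,\dots,z_i),$$ where $P(y)$ is the set of vectors obtained from $y$ by replacing each zero entry by either $1$ or $-1$. For $t_0\in(a,b)$ let $t\mapsto\Phi(t,t_0)$, $t\in(a,b)$, be the solution of $\dot\Phi(t)=A(t)\Phi(t)$ with $\Phi(t_0,t_0)=I$. The system $\dot\Phi=A(t)\Phi$ is called a *cyclic variation diminishing differential system* on $(a,b)$ if $s_c^+(\Phi(t,t_0)x)\le s_c^-(x)$ for all $t_0,t$ with $a<t_0<t<b$ and all $x\in\mathbb{R}^n\setminus\{0\}$.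 Let $\mathcal{Q}\subset\mathbb{R}^{n\times n}$ be the set of matrices that are Metzler (all off-diagonal entries are nonnegative) and whose nonzero entries all lie on the main diagonal, the super- and sub-diagonals, or in positions $(1,n)$ and $(n,1)$. A matrix $M\in\mathbb{R}^{n\times n}$ is reducible if there are a permutation matrix $P$ and an integer $1\le r\le n-1$ such that the lower left $(n-r)\times r$ block of $PMP'$ is zero, and irreducible otherwise (so every $1\times1$ matrix is irreducible). **Theorem.** The following two conditions are equivalent: 1. $A(s)\in\mathcal{Q}$ for all $s\in(a,b)$, and for all $p,q$ with $a<p<q<b$ there exists $t^*\in[p,q]$ such that $A(t^*)$ is irreducible; 2. the system $\dot\Phi=A(t)\Phi$ is a cyclic variation diminishing differential system on $(a,b)$. -/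

import Mathlib

/-- The number of indices `k` with `y k * y (k+1) < 0` in a finite sequence of reals. -/
noncomputable def signChanges : List ℝ → ℕ
  | u :: v :: l => (if u * v < 0 then 1 else 0) + signChanges (v :: l)
  | _ => 0

/-- `s⁻`: the number of sign changes after all zero entries have been deleted. -/
noncomputable def signVarMinus (l : List ℝ) : ℕ :=
  signChanges (l.filter (fun u => u ≠ 0))

/-- The closed sequence `(y i, …, y (n-1), y 0, …, y i)` of length `n + 1`, which goes once around
the ring of entries of `y`, starting and ending at entry `i`. -/
def cyclicList {n : ℕ} (y : Fin n → ℝ) (i : Fin n) : List ℝ :=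
  (List.ofFn y).rotate i ++ [y i]

/-- The vectors obtained from `y` by replacing each zero entry by either `1` or `-1`. -/
noncomputable def zeroFillings {n : ℕ} (y : Fin n → ℝ) : Finset (Fin n → ℝ) :=
  Fintype.piFinset fun k => if y k = 0 then {1, -1} else {y k}

/-- `s⁻_c`: the maximum over `i` of `s⁻(y i, …, y (n-1), y 0, …, y i)`. -/
noncomputable def cyclicSignVarMinus {n : ℕ} (y : Fin n → ℝ) : ℕ :=
  Finset.univ.sup fun i : Fin n => signVarMinus (cyclicList y i)

/-- `s⁺_c`: the maximum over `i`, and over all ways to replace the zero entries by `1` or `-1`, of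
the number of sign changes of `(y i, …, y (n-1), y 0, …, y i)`. The replacement is made in the
vector `y`, so that both copies of a zero `y i` get the same value. -/
noncomputable def cyclicSignVarPlus {n : ℕ} (y : Fin n → ℝ) : ℕ :=
  Finset.univ.sup fun i : Fin n =>
    (zeroFillings y).sup fun z => signChanges (cyclicList z i)

/-- The strong cyclic variation diminishing property of a square matrix. -/
def StrongCyclicVDP {n : ℕ} (M : Matrix (Fin n) (Fin n) ℝ) : Prop :=
  ∀ x : Fin n → ℝ, x ≠ 0 → cyclicSignVarPlus (M.mulVec x) ≤ cyclicSignVarMinus x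

/-- `Φ t t₀` is the transition matrix of `ẋ = A(t) x` on `(a, b)`: for every `t₀`, the function
`t ↦ Φ t t₀` solves `Φ̇ = A(t) Φ` on `(a, b)` with the value `I` at `t₀`. -/
def IsTransitionMatrix {n : ℕ} (a b : EReal) (A : ℝ → Matrix (Fin n) (Fin n) ℝ)
    (Φ : ℝ → ℝ → Matrix (Fin n) (Fin n) ℝ) : Prop :=
  ∀ t₀ : ℝ, a < t₀ → t₀ < b →
    Φ t₀ t₀ = 1 ∧
    ∀ t : ℝ, a < t → t < b →
      ∀ i j : Fin n, HasDerivAt (fun s => Φ s t₀ i j) ((A t * Φ t t₀) i j) t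

/-- The system `Φ̇ = A(t) Φ` is a cyclic variation diminishing differential system on `(a, b)`:
it has a transition matrix `Φ` (unique on `(a, b)` for continuous `A`), and `Φ t t₀` has the
strong cyclic variation diminishing property whenever `a < t₀ < t < b`. -/
def IsCVDDS {n : ℕ} (a b : EReal) (A : ℝ → Matrix (Fin n) (Fin n) ℝ) : Prop :=
  ∃ Φ : ℝ → ℝ → Matrix (Fin n) (Fin n) ℝ, IsTransitionMatrix a b A Φ ∧
    ∀ t₀ t : ℝ, a < t₀ → t₀ < t → t < b → StrongCyclicVDP (Φ t t₀)

/-- Every off-diagonal entry is nonnegative. -/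
def IsMetzler {n : ℕ} (M : Matrix (Fin n) (Fin n) ℝ) : Prop :=
  ∀ i j : Fin n, i ≠ j → 0 ≤ M i j

/-- The set of `n × n` Metzler matrices whose nonzero entries all lie on the main diagonal, on the
super- and sub-diagonals, or in the corners `(1, n)` and `(n, 1)`. -/
def cyclicMetzlerSet (n : ℕ) : Set (Matrix (Fin n) (Fin n) ℝ) :=
  {M | IsMetzler M ∧ ∀ i j : Fin n, M i j ≠ 0 →
    i = j ∨ (i : ℕ) + 1 = j ∨ (j : ℕ) + 1 = i ∨
    ((i : ℕ) = 0 ∧ (j : ℕ) + 1 = n) ∨ ((i : ℕ) + 1 = n ∧ (j : ℕ) = 0)}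

/-- Some simultaneous permutation of rows and columns brings the matrix to the block form
`[B C; 0 D]` with a zero block of size `(n - r) × r`, where `1 ≤ r ≤ n - 1`. -/
def IsReducibleMatrix {n : ℕ} (M : Matrix (Fin n) (Fin n) ℝ) : Prop :=
  ∃ (π : Equiv.Perm (Fin n)) (r : ℕ), 1 ≤ r ∧ r < n ∧
    ∀ i j : Fin n, r ≤ (i : ℕ) → (j : ℕ) < r → M (π i) (π j) = 0

/-- Not reducible. Mathlib's `Matrix.IsIrreducible` is for entrywise nonnegative matrices, while
the diagonal of a Metzler matrix may be negative. Every `1 × 1` matrix is irreducible. -/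
def IsIrreducibleMatrix {n : ℕ} (M : Matrix (Fin n) (Fin n) ℝ) : Prop :=
  ¬ IsReducibleMatrix M

/-!
A sign pattern `σ` is compatible with a vector `y` if it gives every nonzero entry its sign. Then
`s⁻_c(y)` (for `y ≠ 0`) and `s⁺_c(y)` are the minimum and the maximum of the number of cyclic sign
changes of `σ` over the patterns compatible with `y`, and most of the proof is about patterns.

*Sufficiency.* Adding a nonnegative multiple of an entry to a neighbouring entry does not raise the
minimum. Products of such elementary operations and of positive scalings of single entries are
tangent to every matrix of the cyclic Metzler set, and the vectors with minimum at most `m` form a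
closed set. Hence this set is invariant under the flow: by Grönwall's inequality the distance of a
solution to it, being zero at first, stays zero (`IsLinearSolution.mem_of_mem`). Following slightly
perturbed solutions shows that the maximum does not increase along solutions either
(`IsLinearSolution.exists_cyclicChanges_ge`). It remains to find, between two given times, one time
at which minimum and maximum agree. They agree when every zero entry sits between two entries of
opposite signs. If this failed throughout an interval, then by the Baire category theorem a set of
entries would vanish identically on a subinterval without input from the other entries, so that `A`
would be reducible there (`IsLinearSolution.exists_regular_time`).

*Necessity.* Vectors with nonnegative entries have no sign change, so the transition matrices are
positive for `n ≥ 2` (`transitionMatrix_pos`); differentiating at the initial time shows that `A` is Metzler. A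
positive entry outside the cyclic band would create two extra sign changes
(`eq_zero_of_isCVDDS`). If `A` were reducible throughout an interval, then a fixed block of `A`
would vanish on a subinterval by Baire's theorem, and so would a block of the transition matrix
(`exists_irreducible_of_isCVDDS`).

The existence of the transition matrix on the whole interval, which is part of the definition of a
cyclic variation diminishing system, is `exists_isTransitionMatrix`.
-/

open Filter Topology Matrix

/-! ### Sign patterns on the ring and the two cyclic sign counts -/

/-- The vector `y` lies in the closed orthant with sign pattern `σ` (`true` for `+`, `false` for
`-`): the pattern prescribes the sign of every nonzero entry of `y`, and it is a choice of signs
for the zero entries. -/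
def SignCompatible {n : ℕ} (y : Fin n → ℝ) (σ : Fin n → Bool) : Prop :=
  ∀ k, (0 < y k → σ k = true) ∧ (y k < 0 → σ k = false)

theorem signCompatible_decide_pos {n : ℕ} (y : Fin n → ℝ) :
    SignCompatible y fun k => decide (0 < y k) := fun k =>
  ⟨fun h => by simpa using h, fun h => by simpa using h.le⟩

/-- The number of sign changes of a pattern around the ring. The addition in `Fin n` is modulo
`n`, so the summand of the last index compares the last entry with the first. -/
def cyclicChanges {n : ℕ} [NeZero n] (σ : Fin n → Bool) : ℕ :=
  ∑ k, if σ k ≠ σ (k + 1) then 1 else 0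

theorem signChanges_le_cons (w : ℝ) (l : List ℝ) : signChanges l ≤ signChanges (w :: l) := by
  cases l <;> simp [signChanges]

theorem mul_neg_or_mul_neg {u v p : ℝ} (hv : v ≠ 0) (h : u * p < 0) : u * v < 0 ∨ v * p < 0 := by
  rcases lt_or_gt_of_ne hv with hv | hv <;> rcases mul_neg_iff.1 h with ⟨h1, h2⟩ | ⟨h1, h2⟩
  · exact Or.inl (mul_neg_of_pos_of_neg h1 hv)
  · exact Or.inr (mul_neg_of_neg_of_pos hv h2)
  · exact Or.inr (mul_neg_of_pos_of_neg hv h2)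
  · exact Or.inl (mul_neg_of_neg_of_pos h1 hv)

theorem signChanges_cons_le {u v : ℝ} (hv : v ≠ 0) (m : List ℝ) :
    signChanges (u :: m) ≤ (if u * v < 0 then 1 else 0) + signChanges (v :: m) := by
  cases m with
  | nil => simp [signChanges]
  | cons p m =>
    simp only [signChanges]
    by_cases h : u * p < 0
    · rcases mul_neg_or_mul_neg hv h with h1 | h1 <;> simp [h, h1]
    · simp only [h, if_false]; omega

/-- The entry `w` is nonzero, and has the same sign as `u` if `u` is nonzero. -/
def FillsEntry (u w : ℝ) : Prop := w ≠ 0 ∧ (u ≠ 0 → 0 < u * w)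

theorem signChanges_cons_filter_le {l l' : List ℝ} (h : List.Forall₂ FillsEntry l l') {u w : ℝ}
    (huw : 0 < u * w) :
    signChanges (u :: l.filter (fun u => u ≠ 0)) ≤ signChanges (w :: l') := by
  induction h generalizing u w with
  | nil => simp [signChanges]
  | @cons v v' l l' hv _ ih =>
    have hvv : 0 < v' * v' := by exact mul_self_pos.2 hv.1
    have key : (if u * v' < 0 then 1 else 0) = (if w * v' < 0 then 1 else 0) := by
      have : u * v' < 0 ↔ w * v' < 0 := by
        rcases mul_pos_iff.1 huw with ⟨h1, h2⟩ | ⟨h1, h2⟩ <;>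
          simp [mul_neg_iff, h1, h2, h1.not_gt, h2.not_gt]
      simp [this]
    by_cases h0 : v = 0
    · subst h0
      have h1 := signChanges_cons_le (u := u) hv.1 (l.filter (fun u => u ≠ 0))
      have h2 := ih hvv
      have h3 : signChanges (w :: v' :: l')
        = (if w * v' < 0 then 1 else 0) + signChanges (v' :: l') := rfl
      have h4 : (0 :: l).filter (fun u : ℝ => u ≠ 0) = l.filter (fun u => u ≠ 0) := by simp
      rw [h4]
      omega
    · have h2 := ih (hv.2 h0)
      have h4 : (v :: l).filter (fun u : ℝ => u ≠ 0) = v :: l.filter (fun u => u ≠ 0) := by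
        simp [h0]
      have key2 : (if u * v < 0 then 1 else 0) = (if u * v' < 0 then 1 else 0) := by
        have : u * v < 0 ↔ u * v' < 0 := by
          rcases mul_pos_iff.1 (hv.2 h0) with ⟨h1, h2⟩ | ⟨h1, h2⟩ <;>
            simp [mul_neg_iff, h1, h2, h1.not_gt, h2.not_gt]
        simp [this]
      rw [h4]
      simp only [signChanges]
      omega

theorem signVarMinus_le_of_forall₂ {l l' : List ℝ} (h : List.Forall₂ FillsEntry l l') :
    signVarMinus l ≤ signChanges l' := by
  unfold signVarMinus
  induction h with
  | nil => simp
  | @cons v v' l l' hv hl ih =>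
    by_cases h0 : v = 0
    · subst h0
      have h4 : (0 :: l).filter (fun u : ℝ => u ≠ 0) = l.filter (fun u => u ≠ 0) := by simp
      rw [h4]
      exact ih.trans (signChanges_le_cons _ _)
    · have h4 : (v :: l).filter (fun u : ℝ => u ≠ 0) = v :: l.filter (fun u => u ≠ 0) := by
        simp [h0]
      rw [h4]
      exact signChanges_cons_filter_le hl (hv.2 h0)

/-- Filling every zero with a copy of the last nonzero entry before it creates no sign change. -/
theorem exists_fill_signChanges_le (l : List ℝ) {u : ℝ} (hu : u ≠ 0) :
    ∃ l', List.Forall₂ FillsEntry l l' ∧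
      signChanges (u :: l') ≤ signChanges (u :: l.filter (fun u => u ≠ 0)) := by
  induction l generalizing u with
  | nil => exact ⟨[], List.Forall₂.nil, by simp⟩
  | cons v l ih =>
    by_cases h0 : v = 0
    · subst h0
      obtain ⟨l', h1, h2⟩ := ih hu
      refine ⟨u :: l', List.Forall₂.cons ⟨hu, fun h => absurd rfl h⟩ h1, ?_⟩
      have h4 : (0 :: l).filter (fun u : ℝ => u ≠ 0) = l.filter (fun u => u ≠ 0) := by simp
      rw [h4]
      have : ¬ u * u < 0 := (mul_self_nonneg u).not_gt
      simpa [signChanges, this] using h2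
    · obtain ⟨l', h1, h2⟩ := ih h0
      refine ⟨v :: l', List.Forall₂.cons ⟨h0, fun h => mul_self_pos.2 h⟩ h1, ?_⟩
      have h4 : (v :: l).filter (fun u : ℝ => u ≠ 0) = v :: l.filter (fun u => u ≠ 0) := by
        simp [h0]
      rw [h4]
      simpa [signChanges] using h2

theorem signChanges_ofFn {m : ℕ} (v : Fin (m + 1) → ℝ) :
    signChanges (List.ofFn v) = ∑ k : Fin m, if v k.castSucc * v k.succ < 0 then 1 else 0 := by
  induction m with
  | zero => simp [List.ofFn_succ, signChanges]
  | succ m ih =>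
    rw [List.ofFn_succ, List.ofFn_succ, Fin.sum_univ_succ]
    have := ih (fun i => v i.succ)
    rw [List.ofFn_succ] at this
    simp only [signChanges, this]
    rfl

theorem cyclicList_eq_ofFn {n : ℕ} [NeZero n] (y : Fin n → ℝ) (i : Fin n) :
    cyclicList y i = List.ofFn (fun k : Fin (n + 1) => y (i + Fin.ofNat n k)) := by
  apply List.ext_getElem
  · simp [cyclicList]
  · intro k h1 h2
    simp only [cyclicList, List.length_append, List.length_rotate, List.length_ofFn,
      List.length_singleton] at h1
    rw [List.getElem_ofFn]
    by_cases h : k < n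
    · have : (cyclicList y i)[k] = ((List.ofFn y).rotate i)[k]'(by simpa using h) :=
        List.getElem_append_left _
      rw [this, List.getElem_rotate, List.getElem_ofFn]
      congr 1
      ext
      simp [Fin.val_add, add_comm]
    · have hk : n = k := by omega
      have : (cyclicList y i)[k] = [y i][k - ((List.ofFn y).rotate i).length]'(by simp; omega) :=
        List.getElem_append_right (by simp; omega)
      rw [this]
      have : Fin.ofNat n k = 0 := by ext; simp [← hk]
      rw [List.getElem_singleton]
      change y i = y (i + Fin.ofNat n k)
      rw [this, add_zero]

theorem sum_ofNat_eq {n : ℕ} [NeZero n] {M : Type*} [AddCommMonoid M] (i : Fin n)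
    (f : Fin n → Fin n → M) :
    ∑ k : Fin n, f (i + Fin.ofNat n k.castSucc) (i + Fin.ofNat n k.succ) =
      ∑ k, f k (k + 1) := by
  rw [← Equiv.sum_comp (Equiv.addLeft i) (fun k => f k (k + 1))]
  refine Finset.sum_congr rfl fun k _ => ?_
  have h1 : Fin.ofNat n (k.castSucc : ℕ) = k := by ext; simp
  have h2 : Fin.ofNat n (k.succ : ℕ) = k + 1 := by ext; simp [Fin.val_add]
  rw [h1, h2, Equiv.coe_addLeft, add_assoc]

theorem mul_neg_iff_of_compatible {u v : ℝ} {p q : Bool} (hu : u ≠ 0) (hv : v ≠ 0)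
    (hp : (0 < u → p = true) ∧ (u < 0 → p = false))
    (hq : (0 < v → q = true) ∧ (v < 0 → q = false)) : u * v < 0 ↔ p ≠ q := by
  rcases lt_or_gt_of_ne hu with h1 | h1 <;> rcases lt_or_gt_of_ne hv with h2 | h2 <;>
    simp_all [mul_neg_iff, le_of_lt]

theorem signChanges_cyclicList {n : ℕ} [NeZero n] {z : Fin n → ℝ} {σ : Fin n → Bool}
    (hz : ∀ k, z k ≠ 0) (h : SignCompatible z σ) (i : Fin n) :
    signChanges (cyclicList z i) = cyclicChanges σ := by
  rw [cyclicList_eq_ofFn, signChanges_ofFn,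
    sum_ofNat_eq i (fun p q => if z p * z q < 0 then 1 else 0), cyclicChanges]
  refine Finset.sum_congr rfl fun k _ => ?_
  simp only [mul_neg_iff_of_compatible (hz k) (hz (k + 1)) (h k) (h (k + 1))]

/-- The filling of the zeros of `y` by `1` or `-1` as the pattern `σ` prescribes. -/
noncomputable def fillZeros {n : ℕ} (y : Fin n → ℝ) (σ : Fin n → Bool) (k : Fin n) : ℝ :=
  if y k = 0 then (if σ k = true then 1 else -1) else y k

theorem fillZeros_ne_zero {n : ℕ} (y : Fin n → ℝ) (σ : Fin n → Bool) (k : Fin n) :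
    fillZeros y σ k ≠ 0 := by
  unfold fillZeros; split_ifs <;> simp_all

theorem fillZeros_compatible {n : ℕ} {y : Fin n → ℝ} {σ : Fin n → Bool} (h : SignCompatible y σ) :
    SignCompatible (fillZeros y σ) σ := by
  intro k
  have := h k
  unfold fillZeros; split_ifs <;> simp_all

theorem fillZeros_mem {n : ℕ} (y : Fin n → ℝ) (σ : Fin n → Bool) :
    fillZeros y σ ∈ zeroFillings y := by
  rw [zeroFillings, Fintype.mem_piFinset]
  intro k
  unfold fillZeros; split_ifs <;> simp

theorem forall₂_ofFn {m : ℕ} {R : ℝ → ℝ → Prop} {f g : Fin m → ℝ} (h : ∀ k, R (f k) (g k)) :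
    List.Forall₂ R (List.ofFn f) (List.ofFn g) := by
  rw [List.forall₂_iff_get]
  simp [h]

theorem cyclicSignVarMinus_le {n : ℕ} [NeZero n] {y : Fin n → ℝ} {σ : Fin n → Bool}
    (h : SignCompatible y σ) : cyclicSignVarMinus y ≤ cyclicChanges σ := by
  refine Finset.sup_le fun i _ => ?_
  rw [← signChanges_cyclicList (fillZeros_ne_zero y σ) (fillZeros_compatible h) i]
  apply signVarMinus_le_of_forall₂
  rw [cyclicList_eq_ofFn, cyclicList_eq_ofFn]
  refine forall₂_ofFn fun k => ⟨fillZeros_ne_zero _ _ _, fun hy => ?_⟩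
  rw [fillZeros, if_neg hy]
  exact mul_self_pos.2 hy

theorem le_cyclicSignVarPlus {n : ℕ} [NeZero n] {y : Fin n → ℝ} {σ : Fin n → Bool}
    (h : SignCompatible y σ) : cyclicChanges σ ≤ cyclicSignVarPlus y := by
  rw [← signChanges_cyclicList (fillZeros_ne_zero y σ) (fillZeros_compatible h) 0]
  exact (Finset.le_sup (f := fun z => signChanges (cyclicList z 0)) (fillZeros_mem y σ)).trans
    (Finset.le_sup (f := fun i : Fin n =>
      (zeroFillings y).sup fun z => signChanges (cyclicList z i)) (Finset.mem_univ 0))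

theorem cyclicSignVarPlus_le {n : ℕ} [NeZero n] {y : Fin n → ℝ} {m : ℕ}
    (h : ∀ σ, SignCompatible y σ → cyclicChanges σ ≤ m) : cyclicSignVarPlus y ≤ m := by
  refine Finset.sup_le fun i _ => Finset.sup_le fun z hz => ?_
  rw [zeroFillings, Fintype.mem_piFinset] at hz
  have hz0 : ∀ k, z k ≠ 0 := by
    intro k
    have := hz k
    split_ifs at this with h0
    · simp at this; rcases this with h | h <;> rw [h] <;> norm_num
    · simp at this; rwa [this]
  have hzσ := signCompatible_decide_pos z
  rw [signChanges_cyclicList hz0 hzσ]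
  refine h _ fun k => ?_
  have := hz k
  split_ifs at this with h0
  · simp [h0]
  · simp at this; rw [← this]; exact hzσ k

/-- The minimal filling copies the last nonzero entry into every zero, going once around the ring
from a nonzero entry. -/
theorem exists_cyclicChanges_le {n : ℕ} [NeZero n] {y : Fin n → ℝ} (hy : y ≠ 0) :
    ∃ σ, SignCompatible y σ ∧ cyclicChanges σ ≤ cyclicSignVarMinus y := by
  obtain ⟨i, hi⟩ := Function.ne_iff.1 hy
  have hi : y i ≠ 0 := hi
  have hle : signVarMinus (cyclicList y i) ≤ cyclicSignVarMinus y :=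
    Finset.le_sup (f := fun i : Fin n => signVarMinus (cyclicList y i)) (Finset.mem_univ i)
  set v : Fin (n + 1) → ℝ := fun k => y (i + Fin.ofNat n k) with hv
  have hv0 : v 0 = y i := by simp [hv]
  have hvl : v (Fin.last n) = y i := by simp [hv]
  obtain ⟨l', h1, h2⟩ := exists_fill_signChanges_le (List.ofFn (fun k : Fin n => v k.succ)) hi
  have hlist : cyclicList y i = y i :: List.ofFn (fun k : Fin n => v k.succ) := by
    rw [cyclicList_eq_ofFn, List.ofFn_succ]; simp [hv]
  have hlen : l'.length = n := by rw [← h1.length_eq]; simp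
  -- `w` lists the filled values once around the ring, starting and ending at entry `i`.
  obtain ⟨w, hw⟩ : ∃ w : Fin (n + 1) → ℝ, List.ofFn w = y i :: l' :=
    ⟨fun k => (y i :: l')[(k : ℕ)]'(by simp [hlen, Nat.lt_succ_iff.1 k.isLt]), by
      apply List.ext_getElem
      · simp [hlen]
      · intro k _ _; rw [List.getElem_ofFn]⟩
  have hF : List.Forall₂ FillsEntry (List.ofFn v) (List.ofFn w) := by
    rw [hw, List.ofFn_succ, hv0]
    exact List.Forall₂.cons ⟨hi, fun _ => mul_self_pos.2 hi⟩ h1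
  have hvw : ∀ k, FillsEntry (v k) (w k) := by
    intro k
    have := (List.forall₂_iff_get.1 hF).2 k (by rw [List.length_ofFn]; exact k.isLt)
      (by rw [List.length_ofFn]; exact k.isLt)
    simpa only [List.get_eq_getElem, List.getElem_ofFn] using this
  have hw0 : 0 < w 0 ↔ 0 < w (Fin.last n) := by
    have a0 := (hvw 0).2 (by rwa [hv0])
    have al := (hvw (Fin.last n)).2 (by rwa [hvl])
    rw [hv0] at a0
    rw [hvl] at al
    rcases lt_or_gt_of_ne hi with h | h
    · exact iff_of_false (by nlinarith) (by nlinarith)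
    · exact iff_of_true (by nlinarith) (by nlinarith)
  set σ : Fin n → Bool := fun k => decide (0 < w (k - i).castSucc) with hσ
  have hσa : ∀ k : Fin n, σ (i + Fin.ofNat n k.castSucc) = decide (0 < w k.castSucc) := by
    intro k
    simp [hσ]
  have hσb : ∀ k : Fin n, σ (i + Fin.ofNat n k.succ) = decide (0 < w k.succ) := by
    intro k
    by_cases hk : (k : ℕ) + 1 = n
    · have e1 : Fin.ofNat n (k.succ : ℕ) = 0 := by ext; simp [hk]
      have e2 : k.succ = Fin.last n := by ext; simp [hk]
      rw [e1, e2]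
      simpa [hσ] using hw0
    · have hlt : (k : ℕ) + 1 < n := by omega
      have e1 : (Fin.ofNat n (k.succ : ℕ)).castSucc = k.succ := by
        ext; simp [Nat.mod_eq_of_lt hlt]
      simp only [hσ, add_sub_cancel_left, e1]
  refine ⟨σ, fun k => ?_, ?_⟩
  · have hk := hvw (k - i).castSucc
    have e : v (k - i).castSucc = y k := by
      simp [hv]
    rw [e] at hk
    refine ⟨fun h => ?_, fun h => ?_⟩
    · have := hk.2 h.ne'
      simp only [hσ, decide_eq_true_eq]; nlinarith
    · have := hk.2 h.ne
      simp only [hσ, decide_eq_false_iff_not]; nlinarith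
  · have hwne : ∀ k, w k ≠ 0 := fun k => (hvw k).1
    have hcc : cyclicChanges σ = signChanges (y i :: l') := by
      rw [← hw, signChanges_ofFn, cyclicChanges,
        ← sum_ofNat_eq i (fun p q => if σ p ≠ σ q then 1 else 0)]
      refine Finset.sum_congr rfl fun k _ => ?_
      have hc : ∀ u : ℝ, (0 < u → decide (0 < u) = true) ∧ (u < 0 → decide (0 < u) = false) :=
        fun u => ⟨fun h => by simpa using h, fun h => by simpa using h.le⟩
      simp only [hσa, hσb, mul_neg_iff_of_compatible (hwne _) (hwne _) (hc _) (hc _)]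
    rw [hcc]
    refine h2.trans ((le_of_eq ?_).trans hle)
    rw [hlist, signVarMinus]
    simp [hi]

/-! ### How the number of sign changes responds to changes of one entry -/

theorem cyclicChanges_update {n : ℕ} [NeZero n] {i : Fin n} (hi : i - 1 ≠ i) (σ : Fin n → Bool)
    (b : Bool) :
    cyclicChanges (Function.update σ i b) + ((if σ (i - 1) ≠ σ i then 1 else 0) +
        (if σ i ≠ σ (i + 1) then 1 else 0)) =
      cyclicChanges σ + ((if σ (i - 1) ≠ b then 1 else 0) +
        (if b ≠ σ (i + 1) then 1 else 0)) := by
  have hi' : i + 1 ≠ i := fun h => hi (by rw [sub_eq_iff_eq_add]; exact h.symm)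
  have key : ∀ (p q : ℕ), p + q = ∑ k : Fin n, ((if k = i - 1 then p else 0) +
      (if k = i then q else 0)) := by
    intro p q
    simp [Finset.sum_add_distrib]
  rw [key (if σ (i - 1) ≠ σ i then 1 else 0), key (if σ (i - 1) ≠ b then 1 else 0),
    cyclicChanges, cyclicChanges, ← Finset.sum_add_distrib, ← Finset.sum_add_distrib]
  refine Finset.sum_congr rfl fun k _ => ?_
  by_cases h1 : k = i
  · subst h1
    simp [hi.symm, hi', add_comm]
  · by_cases h2 : k = i - 1
    · subst h2
      simp [hi, add_comm]
    · have h3 : k + 1 ≠ i := fun h => h2 (by rw [← h]; simp)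
      simp [h1, h2, h3]

/-- Adding a nonnegative multiple of an entry to a neighbour changes the sign of the neighbour at
most to the sign of that entry, which creates no new sign change. -/
theorem SignCompatible.exists_update_add {n : ℕ} [NeZero n] {y : Fin n → ℝ} {σ : Fin n → Bool}
    (h : SignCompatible y σ) {i j : Fin n} (hij : j = i + 1 ∨ i = j + 1) {c : ℝ} (hc : 0 ≤ c) :
    ∃ σ', SignCompatible (Function.update y i (y i + c * y j)) σ' ∧
      cyclicChanges σ' ≤ cyclicChanges σ := by
  by_cases hcomp : (0 < y i + c * y j → σ i = true) ∧ (y i + c * y j < 0 → σ i = false)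
  · refine ⟨σ, fun k => ?_, le_rfl⟩
    by_cases hk : k = i
    · subst hk; simpa using hcomp
    · simpa [hk] using h k
  · have hne : i ≠ j := by
      rintro rfl
      apply hcomp
      constructor <;> intro h'
      · exact (h i).1 (by nlinarith)
      · exact (h i).2 (by nlinarith)
    have hi : i - 1 ≠ i := by
      intro h'
      have h1 : i + 1 = i := by rw [sub_eq_iff_eq_add] at h'; exact h'.symm
      rcases hij with h2 | h2
      · exact hne (by rw [h2, h1])
      · have h3 : (1 : Fin n) = 0 := by simpa using h1
        rw [h3, add_zero] at h2
        exact hne h2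
    refine ⟨Function.update σ i (σ j), fun k => ?_, ?_⟩
    · by_cases hk : k = i
      · subst hk
        simp only [Function.update_self]
        refine ⟨fun hp => (h j).1 ?_, fun hp => (h j).2 ?_⟩
        · by_contra hj
          refine hcomp ⟨fun _ => (h k).1 ?_, fun h' => absurd h' hp.not_gt⟩
          nlinarith
        · by_contra hj
          refine hcomp ⟨fun h' => absurd h' hp.not_gt, fun _ => (h k).2 ?_⟩
          nlinarith
      · simpa [hk] using h k
    · have := cyclicChanges_update hi σ (σ j)
      rcases hij with h2 | h2
      · rw [h2] at this ⊢
        revert this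
        generalize cyclicChanges (Function.update σ i (σ (i + 1))) = X
        cases σ (i - 1) <;> cases σ i <;> cases σ (i + 1) <;> simp <;> omega
      · have h3 : j = i - 1 := by rw [h2]; simp
        rw [h3] at this ⊢
        revert this
        generalize cyclicChanges (Function.update σ i (σ (i - 1))) = X
        cases σ (i - 1) <;> cases σ i <;> cases σ (i + 1) <;> simp <;> omega

/-- If every zero of `y` sits between two entries of opposite signs, then the number of sign
changes does not depend on the signs chosen for the zeros. -/
theorem cyclicChanges_eq_of_regular {n : ℕ} [NeZero n] {y : Fin n → ℝ}
    (hreg : ∀ k, y k = 0 → y (k - 1) * y (k + 1) < 0) {σ τ : Fin n → Bool}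
    (hσ : SignCompatible y σ) (hτ : SignCompatible y τ) : cyclicChanges σ = cyclicChanges τ := by
  suffices H : ∀ (s : Finset (Fin n)) (σ : Fin n → Bool), SignCompatible y σ →
      (∀ k, σ k ≠ τ k → k ∈ s) → cyclicChanges σ = cyclicChanges τ from
    H Finset.univ σ hσ fun k _ => Finset.mem_univ k
  intro s
  induction s using Finset.induction_on with
  | empty =>
    intro σ _ h
    have : σ = τ := funext fun k => by by_contra hk; simpa using h k hk
    rw [this]
  | @insert i s hi ih =>
    intro σ hσ h
    by_cases hit : σ i = τ i
    · refine ih σ hσ fun k hk => (Finset.mem_insert.1 (h k hk)).resolve_left ?_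
      rintro rfl; exact hk hit
    have hyi : y i = 0 := by
      by_contra h0
      rcases lt_or_gt_of_ne h0 with h1 | h1
      · exact hit (((hσ i).2 h1).trans ((hτ i).2 h1).symm)
      · exact hit (((hσ i).1 h1).trans ((hτ i).1 h1).symm)
    have hr := hreg i hyi
    have hi1 : i - 1 ≠ i := by
      intro h'; rw [h', hyi] at hr; simp at hr
    have hopp : σ (i - 1) ≠ σ (i + 1) := by
      rcases mul_neg_iff.1 hr with ⟨h1, h2⟩ | ⟨h1, h2⟩
      · simp [(hσ _).1 h1, (hσ _).2 h2]
      · simp [(hσ _).2 h1, (hσ _).1 h2]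
    have hup := cyclicChanges_update hi1 σ (τ i)
    rw [← ih (Function.update σ i (τ i)) ?_ ?_]
    · revert hup hopp
      generalize cyclicChanges (Function.update σ i (τ i)) = X
      cases σ (i - 1) <;> cases σ i <;> cases σ (i + 1) <;> cases τ i <;> simp <;> omega
    · intro k
      by_cases hk : k = i
      · subst hk; simpa using hτ k
      · simpa [hk] using hσ k
    · intro k hk
      by_cases hki : k = i
      · subst hki; simp at hk
      · rw [Function.update_of_ne hki] at hk
        exact (Finset.mem_insert.1 (h k hk)).resolve_left hki

/-! ### Closed sets of vectors with few sign changes, and matrices that preserve them -/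

/-- The vectors whose zeros can be given signs such that there are at most `m` cyclic sign
changes. For a nonzero vector this says that `s⁻_c` is at most `m`. -/
def fewChanges (n : ℕ) [NeZero n] (m : ℕ) : Set (Fin n → ℝ) :=
  {y | ∃ σ, SignCompatible y σ ∧ cyclicChanges σ ≤ m}

theorem isClosed_signCompatible {n : ℕ} (σ : Fin n → Bool) :
    IsClosed {y : Fin n → ℝ | SignCompatible y σ} := by
  have : {y : Fin n → ℝ | SignCompatible y σ} =
      ⋂ k, {y | if σ k = true then 0 ≤ y k else y k ≤ 0} := by
    ext y
    simp only [SignCompatible, Set.mem_ofPred_eq, Set.mem_iInter]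
    refine forall_congr' fun k => ?_
    cases σ k <;> simp
  rw [this]
  refine isClosed_iInter fun k => ?_
  cases σ k
  · simpa using isClosed_le (continuous_apply k) continuous_const
  · simpa using isClosed_le continuous_const (continuous_apply k)

theorem isClosed_fewChanges (n : ℕ) [NeZero n] (m : ℕ) : IsClosed (fewChanges n m) := by
  have : fewChanges n m = ⋃ σ ∈ {σ : Fin n → Bool | cyclicChanges σ ≤ m},
      {y : Fin n → ℝ | SignCompatible y σ} := by
    ext y; simp [fewChanges, and_comm]
  rw [this]
  exact (Set.toFinite _).isClosed_biUnion fun σ _ => isClosed_signCompatible σ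

/-- The matrix `M` maps vectors with few cyclic sign changes to vectors with few cyclic sign
changes (weak cyclic variation diminution). -/
def PreservesFewChanges {n : ℕ} [NeZero n] (M : Matrix (Fin n) (Fin n) ℝ) : Prop :=
  ∀ m, ∀ y ∈ fewChanges n m, M *ᵥ y ∈ fewChanges n m

theorem preservesFewChanges_one {n : ℕ} [NeZero n] :
    PreservesFewChanges (1 : Matrix (Fin n) (Fin n) ℝ) := fun m y hy => by simpa using hy

theorem PreservesFewChanges.mul {n : ℕ} [NeZero n] {M N : Matrix (Fin n) (Fin n) ℝ}
    (hM : PreservesFewChanges M) (hN : PreservesFewChanges N) : PreservesFewChanges (M * N) :=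
  fun m y hy => by rw [← Matrix.mulVec_mulVec]; exact hM m _ (hN m y hy)

theorem one_add_single_mulVec {n : ℕ} (i j : Fin n) (c : ℝ) (y : Fin n → ℝ) :
    (1 + Matrix.single i j c) *ᵥ y = Function.update y i (y i + c * y j) := by
  rw [Matrix.add_mulVec, Matrix.one_mulVec, Matrix.single_mulVec]
  ext k
  by_cases hk : k = i
  · subst hk; simp
  · simp [hk]

theorem preservesFewChanges_one_add_single {n : ℕ} [NeZero n] {i j : Fin n} {c : ℝ}
    (h : (i = j ∧ 0 < 1 + c) ∨ ((j = i + 1 ∨ i = j + 1) ∧ 0 ≤ c)) :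
    PreservesFewChanges (1 + Matrix.single i j c) := by
  rintro m y ⟨σ, hσ, hm⟩
  rw [one_add_single_mulVec]
  rcases h with ⟨rfl, hc⟩ | ⟨hij, hc⟩
  · refine ⟨σ, fun k => ?_, hm⟩
    by_cases hk : k = i
    · subst hk
      have e : y k + c * y k = (1 + c) * y k := by ring
      simp only [Function.update_self, e]
      refine ⟨fun h => (hσ k).1 ((mul_pos_iff_of_pos_left hc).1 h), fun h => (hσ k).2 ?_⟩
      nlinarith
    · simpa [hk] using hσ k
  · obtain ⟨σ', h1, h2⟩ := hσ.exists_update_add hij hc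
    exact ⟨σ', h1, h2.trans hm⟩

theorem eventually_signs_eq {n : ℕ} (y : Fin n → ℝ) :
    ∀ᶠ z in 𝓝 y, ∀ k, (0 < y k → 0 < z k) ∧ (y k < 0 → z k < 0) := by
  refine eventually_all.2 fun k => ?_
  have hc : Tendsto (fun z : Fin n → ℝ => z k) (𝓝 y) (𝓝 (y k)) := (continuous_apply k).tendsto y
  rcases lt_trichotomy (y k) 0 with h | h | h
  · filter_upwards [hc.eventually_lt_const h] with z hz
    exact ⟨fun h' => absurd h' h.not_gt, fun _ => hz⟩
  · simp [h]
  · filter_upwards [hc.eventually_const_lt h] with z hz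
    exact ⟨fun _ => hz, fun h' => absurd h' h.not_gt⟩

/-- Near `y`, a pattern compatible with a vector is compatible with `y`, as nonzero entries keep
their signs. This is the semicontinuity of both sign counts. -/
theorem eventually_signCompatible {n : ℕ} (y : Fin n → ℝ) :
    ∀ᶠ z in 𝓝 y, ∀ σ, SignCompatible z σ → SignCompatible y σ := by
  filter_upwards [eventually_signs_eq y] with z hz σ hσ k
  exact ⟨fun h => (hσ k).1 ((hz k).1 h), fun h => (hσ k).2 ((hz k).2 h)⟩

/-! ### Generators of flows that preserve vectors with few sign changes -/

/-- The matrix `B` is the derivative at `0` of a curve of matrices through the identity that, for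
small positive parameters, do not raise the number of cyclic sign changes. -/
def IsFewChangesTangent {n : ℕ} [NeZero n] (B : Matrix (Fin n) (Fin n) ℝ) : Prop :=
  ∃ M : ℝ → Matrix (Fin n) (Fin n) ℝ, M 0 = 1 ∧
    (∀ i j, HasDerivAt (fun h => M h i j) (B i j) 0) ∧
    ∀ᶠ h in 𝓝[>] (0 : ℝ), PreservesFewChanges (M h)

theorem isFewChangesTangent_zero {n : ℕ} [NeZero n] :
    IsFewChangesTangent (0 : Matrix (Fin n) (Fin n) ℝ) :=
  ⟨fun _ => 1, rfl, fun i j => by simpa using hasDerivAt_const (0 : ℝ) _,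
    Eventually.of_forall fun _ => preservesFewChanges_one⟩

theorem IsFewChangesTangent.add {n : ℕ} [NeZero n] {B C : Matrix (Fin n) (Fin n) ℝ}
    (hB : IsFewChangesTangent B) (hC : IsFewChangesTangent C) : IsFewChangesTangent (B + C) := by
  obtain ⟨M, M0, hM, hMp⟩ := hB
  obtain ⟨N, N0, hN, hNp⟩ := hC
  refine ⟨fun h => M h * N h, by simp [M0, N0], fun i j => ?_, ?_⟩
  · have : HasDerivAt (fun h => ∑ k, M h i k * N h k j)
        (∑ k, (B i k * N 0 k j + M 0 i k * C k j)) 0 :=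
      HasDerivAt.fun_sum fun k _ => (hM i k).mul (hN k j)
    have e : ∑ k, (B i k * N 0 k j + M 0 i k * C k j) = (B + C) i j := by
      rw [M0, N0, Finset.sum_add_distrib, ← Matrix.mul_apply, ← Matrix.mul_apply]
      simp
    rw [e] at this
    exact this
  · filter_upwards [hMp, hNp] with h h1 h2 using h1.mul h2

theorem isFewChangesTangent_single {n : ℕ} [NeZero n] {i j : Fin n} {c : ℝ}
    (h : i = j ∨ ((j = i + 1 ∨ i = j + 1) ∧ 0 ≤ c)) :
    IsFewChangesTangent (Matrix.single i j c) := by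
  refine ⟨fun t => 1 + Matrix.single i j (t * c), by simp, fun k l => ?_, ?_⟩
  · have h1 : (fun t : ℝ => (1 + Matrix.single i j (t * c)) k l) = fun t : ℝ =>
        (1 : Matrix (Fin n) (Fin n) ℝ) k l + t * Matrix.single i j c k l := by
      ext t
      simp [Matrix.single_apply]
    rw [h1]
    simpa using ((hasDerivAt_id (0 : ℝ)).mul_const (Matrix.single i j c k l)).const_add
      ((1 : Matrix (Fin n) (Fin n) ℝ) k l)
  · have h0 : ∀ᶠ t : ℝ in 𝓝[>] 0, 0 < 1 + t * c := by
      have : Tendsto (fun t : ℝ => 1 + t * c) (𝓝 0) (𝓝 (1 + 0 * c)) :=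
        Continuous.tendsto (by fun_prop) 0
      exact nhdsWithin_le_nhds (this.eventually_const_lt (by simp))
    filter_upwards [h0, self_mem_nhdsWithin] with t ht ht0
    apply preservesFewChanges_one_add_single
    rcases h with h | ⟨h, hc⟩
    · exact Or.inl ⟨h, ht⟩
    · exact Or.inr ⟨h, mul_nonneg (le_of_lt ht0) hc⟩

theorem fin_add_one_eq_iff {n : ℕ} [NeZero n] {i j : Fin n} :
    j = i + 1 ↔ (i : ℕ) + 1 = j ∨ ((i : ℕ) + 1 = n ∧ (j : ℕ) = 0) := by
  rw [Fin.ext_iff, Fin.val_add, Fin.val_one', Nat.add_mod_mod]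
  by_cases h : (i : ℕ) + 1 = n
  · rw [h, Nat.mod_self]
    have := j.isLt
    omega
  · have : (i : ℕ) + 1 < n := by have := i.isLt; omega
    rw [Nat.mod_eq_of_lt this]
    omega

theorem mem_cyclicMetzlerSet_iff {n : ℕ} [NeZero n] {M : Matrix (Fin n) (Fin n) ℝ} :
    M ∈ cyclicMetzlerSet n ↔ (∀ i j, i ≠ j → 0 ≤ M i j) ∧
      ∀ i j, M i j ≠ 0 → i = j ∨ j = i + 1 ∨ i = j + 1 := by
  simp only [cyclicMetzlerSet, IsMetzler, Set.mem_ofPred_eq, fin_add_one_eq_iff]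
  refine and_congr_right fun _ => forall_congr' fun i => forall_congr' fun j =>
    imp_congr_right fun _ => ?_
  tauto

theorem isFewChangesTangent_of_mem {n : ℕ} [NeZero n] {M : Matrix (Fin n) (Fin n) ℝ}
    (hM : M ∈ cyclicMetzlerSet n) : IsFewChangesTangent M := by
  rw [mem_cyclicMetzlerSet_iff] at hM
  rw [Matrix.matrix_eq_sum_single M]
  have hadd : ∀ B C : Matrix (Fin n) (Fin n) ℝ, IsFewChangesTangent B → IsFewChangesTangent C →
      IsFewChangesTangent (B + C) := fun _ _ => IsFewChangesTangent.add
  refine Finset.sum_induction _ _ hadd isFewChangesTangent_zero fun i _ =>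
    Finset.sum_induction _ _ hadd isFewChangesTangent_zero fun j _ => ?_
  by_cases h0 : M i j = 0
  · rw [h0, Matrix.single_zero]; exact isFewChangesTangent_zero
  · apply isFewChangesTangent_single
    by_cases hij : i = j
    · exact Or.inl hij
    · exact Or.inr ⟨(hM.2 i j h0).resolve_left hij, hM.1 i j hij⟩

/-! ### Linear differential equations on an interval -/

theorem norm_mulVec_le_sum {n : ℕ} (M : Matrix (Fin n) (Fin n) ℝ) (v : Fin n → ℝ) :
    ‖M *ᵥ v‖ ≤ (∑ i, ∑ j, |M i j|) * ‖v‖ := by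
  have h0 : ∀ i, 0 ≤ ∑ j, |M i j| := fun i => Finset.sum_nonneg fun j _ => abs_nonneg _
  rw [pi_norm_le_iff_of_nonneg (mul_nonneg (Finset.sum_nonneg fun i _ => h0 i) (norm_nonneg v))]
  intro i
  calc ‖(M *ᵥ v) i‖ ≤ ∑ j, |M i j| * ‖v‖ := by
        change ‖∑ j, M i j * v j‖ ≤ _
        refine (norm_sum_le _ _).trans (Finset.sum_le_sum fun j _ => ?_)
        rw [norm_mul, Real.norm_eq_abs]
        exact mul_le_mul_of_nonneg_left (norm_le_pi_norm v j) (abs_nonneg _)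
    _ = (∑ j, |M i j|) * ‖v‖ := by rw [Finset.sum_mul]
    _ ≤ _ := mul_le_mul_of_nonneg_right
        (Finset.single_le_sum (f := fun i => ∑ j, |M i j|) (fun i _ => h0 i) (Finset.mem_univ i))
        (norm_nonneg v)

theorem continuousOn_entry {n : ℕ} {A : ℝ → Matrix (Fin n) (Fin n) ℝ} {s : Set ℝ}
    (hA : ContinuousOn A s) (i j : Fin n) : ContinuousOn (fun t => A t i j) s :=
  continuousOn_pi.1 (continuousOn_pi.1 hA i) j

theorem exists_entry_sum_le {n : ℕ} {A : ℝ → Matrix (Fin n) (Fin n) ℝ} {p q : ℝ}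
    (hA : ContinuousOn A (Set.Icc p q)) :
    ∃ C : NNReal, ∀ t ∈ Set.Icc p q, ∑ i, ∑ j, |A t i j| ≤ C := by
  have hc : ContinuousOn (fun t => ∑ i, ∑ j, |A t i j|) (Set.Icc p q) :=
    continuousOn_finsetSum _ fun i _ => continuousOn_finsetSum _ fun j _ =>
      (continuousOn_entry hA i j).abs
  obtain ⟨C, hC⟩ := isCompact_Icc.bddAbove_image hc
  refine ⟨C.toNNReal, fun t ht => ?_⟩
  exact (hC ⟨t, ht, rfl⟩).trans (Real.le_coe_toNNReal C)

theorem lipschitzWith_mulVec {n : ℕ} {M : Matrix (Fin n) (Fin n) ℝ} {C : NNReal}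
    (h : ∑ i, ∑ j, |M i j| ≤ C) : LipschitzWith C (fun v : Fin n → ℝ => M *ᵥ v) := by
  refine LipschitzWith.of_dist_le_mul fun v w => ?_
  rw [dist_eq_norm, dist_eq_norm, ← Matrix.mulVec_sub]
  exact (norm_mulVec_le_sum _ _).trans (mul_le_mul_of_nonneg_right h (norm_nonneg _))

/-- The curve `x` solves `ẋ = A(t) x` at every time of `s`. -/
def IsLinearSolution {n : ℕ} (A : ℝ → Matrix (Fin n) (Fin n) ℝ) (s : Set ℝ)
    (x : ℝ → Fin n → ℝ) : Prop :=
  ∀ t ∈ s, HasDerivAt x (A t *ᵥ x t) t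

theorem IsLinearSolution.mono {n : ℕ} {A : ℝ → Matrix (Fin n) (Fin n) ℝ} {s s' : Set ℝ}
    {x : ℝ → Fin n → ℝ} (h : IsLinearSolution A s x) (hs : s' ⊆ s) : IsLinearSolution A s' x :=
  fun t ht => h t (hs ht)

theorem IsLinearSolution.continuousOn {n : ℕ} {A : ℝ → Matrix (Fin n) (Fin n) ℝ} {s : Set ℝ}
    {x : ℝ → Fin n → ℝ} (h : IsLinearSolution A s x) : ContinuousOn x s :=
  fun t ht => (h t ht).continuousAt.continuousWithinAt

theorem IsLinearSolution.add_smul {n : ℕ} {A : ℝ → Matrix (Fin n) (Fin n) ℝ} {s : Set ℝ}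
    {x y : ℝ → Fin n → ℝ} (hx : IsLinearSolution A s x) (hy : IsLinearSolution A s y) (c : ℝ) :
    IsLinearSolution A s (fun t => x t + c • y t) := fun t ht => by
  have := (hx t ht).add ((hy t ht).const_smul c)
  rw [Matrix.mulVec_add, Matrix.mulVec_smul]
  exact this

theorem IsLinearSolution.eq_zero {n : ℕ} {A : ℝ → Matrix (Fin n) (Fin n) ℝ} {U : Set ℝ}
    (hU : U.OrdConnected) (hA : ContinuousOn A U) {x : ℝ → Fin n → ℝ}
    (hx : IsLinearSolution A U x) {t₀ t : ℝ} (ht₀ : t₀ ∈ U) (ht : t ∈ U) (h0 : x t₀ = 0) :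
    x t = 0 := by
  have hz : ∀ τ, HasDerivAt (fun _ : ℝ => (0 : Fin n → ℝ)) (A τ *ᵥ 0) τ := fun τ => by
    simpa using hasDerivAt_const τ (0 : Fin n → ℝ)
  rcases le_total t₀ t with h | h
  · have hsub := hU.out ht₀ ht
    obtain ⟨C, hC⟩ := exists_entry_sum_le (hA.mono hsub)
    exact ODE_solution_unique_of_mem_Icc_right (v := fun τ v => A τ *ᵥ v) (s := fun _ => Set.univ)
      (g := fun _ => 0)
      (fun τ hτ => (lipschitzWith_mulVec (hC τ (Set.Ico_subset_Icc_self hτ))).lipschitzOnWith)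
      (hx.mono hsub).continuousOn
      (fun τ hτ => (hx τ (hsub (Set.Ico_subset_Icc_self hτ))).hasDerivWithinAt)
      (fun _ _ => trivial) continuousOn_const (fun τ _ => (hz τ).hasDerivWithinAt)
      (fun _ _ => trivial) h0 (Set.right_mem_Icc.2 h)
  · have hsub := hU.out ht ht₀
    obtain ⟨C, hC⟩ := exists_entry_sum_le (hA.mono hsub)
    exact ODE_solution_unique_of_mem_Icc_left (v := fun τ v => A τ *ᵥ v) (s := fun _ => Set.univ)
      (g := fun _ => 0)
      (fun τ hτ => (lipschitzWith_mulVec (hC τ (Set.Ioc_subset_Icc_self hτ))).lipschitzOnWith)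
      (hx.mono hsub).continuousOn
      (fun τ hτ => (hx τ (hsub (Set.Ioc_subset_Icc_self hτ))).hasDerivWithinAt)
      (fun _ _ => trivial) continuousOn_const (fun τ _ => (hz τ).hasDerivWithinAt)
      (fun _ _ => trivial) h0 (Set.left_mem_Icc.2 h)

theorem IsLinearSolution.eq_of_eq {n : ℕ} {A : ℝ → Matrix (Fin n) (Fin n) ℝ} {U : Set ℝ}
    (hU : U.OrdConnected) (hA : ContinuousOn A U) {x y : ℝ → Fin n → ℝ}
    (hx : IsLinearSolution A U x) (hy : IsLinearSolution A U y) {t₀ t : ℝ} (ht₀ : t₀ ∈ U)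
    (ht : t ∈ U) (h0 : x t₀ = y t₀) : x t = y t := by
  have := (hx.add_smul hy (-1)).eq_zero hU hA ht₀ ht (by simp [h0])
  simpa [add_neg_eq_zero] using this

/-- A vector field that is Lipschitz and vanishes at the origin lets the norm grow at most
exponentially. -/
theorem norm_le_of_lipschitz_field {E : Type*} [NormedAddCommGroup E] [NormedSpace ℝ E]
    {v : ℝ → E → E} {K : NNReal} {a b : ℝ} {x : ℝ → E}
    (hv : ∀ t ∈ Set.Icc a b, LipschitzWith K (v t)) (hv0 : ∀ t ∈ Set.Icc a b, v t 0 = 0)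
    (hx : ∀ t ∈ Set.Icc a b, HasDerivWithinAt x (v t (x t)) (Set.Icc a b) t) {t : ℝ}
    (ht : t ∈ Set.Icc a b) : ‖x t‖ ≤ ‖x a‖ * Real.exp (K * (t - a)) := by
  have := dist_le_of_trajectories_ODE_of_mem (v := v) (s := fun _ => Set.univ) (g := fun _ => 0)
    (δ := ‖x a‖) (K := K)
    (fun τ hτ => (hv τ (Set.Ico_subset_Icc_self hτ)).lipschitzOnWith)
    (fun τ hτ => (hx τ hτ).continuousWithinAt)
    (fun τ hτ => (hx τ (Set.Ico_subset_Icc_self hτ)).mono_of_mem_nhdsWithin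
      (Icc_mem_nhdsGE_of_mem hτ)) (fun _ _ => trivial) continuousOn_const
    (fun τ hτ => by
      rw [hv0 τ (Set.Ico_subset_Icc_self hτ)]; exact hasDerivWithinAt_const _ _ _)
    (fun _ _ => trivial) (by simp) t ht
  simpa using this

/-- The time-reversed form of `norm_le_of_lipschitz_field`. -/
theorem norm_le_of_lipschitz_field_left {E : Type*} [NormedAddCommGroup E] [NormedSpace ℝ E]
    {v : ℝ → E → E} {K : NNReal} {a b : ℝ} {x : ℝ → E}
    (hv : ∀ t ∈ Set.Icc a b, LipschitzWith K (v t)) (hv0 : ∀ t ∈ Set.Icc a b, v t 0 = 0)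
    (hx : ∀ t ∈ Set.Icc a b, HasDerivWithinAt x (v t (x t)) (Set.Icc a b) t) {t : ℝ}
    (ht : t ∈ Set.Icc a b) : ‖x t‖ ≤ ‖x b‖ * Real.exp (K * (b - t)) := by
  have hmap : Set.MapsTo Neg.neg (Set.Icc (-b) (-a)) (Set.Icc a b) := fun s hs =>
    ⟨by linarith [hs.2], by linarith [hs.1]⟩
  have := norm_le_of_lipschitz_field (v := fun s z => -v (-s) z) (K := K) (a := -b) (b := -a)
    (x := fun s => x (-s)) (fun s hs => (hv (-s) (hmap hs)).neg)
    (fun s hs => by rw [hv0 (-s) (hmap hs), neg_zero])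
    (fun s hs => by
      have := HasDerivWithinAt.scomp s (hx (-s) (hmap hs)) (hasDerivAt_neg s).hasDerivWithinAt hmap
      simpa [Function.comp_def] using this)
    (t := -t) ⟨by linarith [ht.2], by linarith [ht.1]⟩
  simpa [add_comm, sub_eq_add_neg] using this

/-- The projection of a vector to the cube of half side `R`, entry by entry. -/
noncomputable def clampVec {n : ℕ} (R : ℝ) (x : Fin n → ℝ) : Fin n → ℝ :=
  fun i => max (-R) (min R (x i))

theorem lipschitzWith_clampVec {n : ℕ} (R : ℝ) :
    LipschitzWith 1 (clampVec R : (Fin n → ℝ) → Fin n → ℝ) := by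
  refine LipschitzWith.of_dist_le_mul fun x y => ?_
  rw [NNReal.coe_one, one_mul]
  refine (dist_pi_le_iff dist_nonneg).2 fun i => ?_
  have h : LipschitzWith 1 (fun u : ℝ => max (-R) (min R u)) :=
    (LipschitzWith.id.const_min R).const_max (-R)
  have := h.dist_le_mul (x i) (y i)
  rw [NNReal.coe_one, one_mul] at this
  exact this.trans (dist_le_pi_dist x y i)

theorem clampVec_of_norm_le {n : ℕ} {R : ℝ} {x : Fin n → ℝ} (h : ‖x‖ ≤ R) : clampVec R x = x := by
  ext i
  have := abs_le.1 ((norm_le_pi_norm x i).trans h)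
  simp [clampVec, this.1, this.2]

theorem norm_clampVec_le {n : ℕ} {R : ℝ} (hR : 0 ≤ R) (x : Fin n → ℝ) : ‖clampVec R x‖ ≤ R := by
  rw [pi_norm_le_iff_of_nonneg hR]
  intro i
  rw [Real.norm_eq_abs, abs_le, clampVec]
  exact ⟨le_max_left _ _, max_le (by linarith) (min_le_left _ _)⟩

/-- Existence on a compact interval. The Picard-Lindelöf theorem is applied to the bounded field
`A(t) clamp(x)`; its solution stays where the clamping is inactive. -/
theorem exists_isLinearSolution_Ioo {n : ℕ} {A : ℝ → Matrix (Fin n) (Fin n) ℝ} {p q t₀ : ℝ}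
    (hA : ContinuousOn A (Set.Icc p q)) (ht₀ : t₀ ∈ Set.Icc p q) (x₀ : Fin n → ℝ) :
    ∃ x, x t₀ = x₀ ∧ IsLinearSolution A (Set.Ioo p q) x := by
  obtain ⟨C, hC⟩ := exists_entry_sum_le hA
  set R : NNReal := ⟨‖x₀‖ * Real.exp (C * (q - p)), by positivity⟩ with hR
  set f : ℝ → (Fin n → ℝ) → Fin n → ℝ := fun t x => A t *ᵥ clampVec R x with hf
  have hlip : ∀ t ∈ Set.Icc p q, LipschitzWith C (f t) := fun t ht => by
    have := (lipschitzWith_mulVec (hC t ht)).comp (lipschitzWith_clampVec (n := n) R)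
    rwa [mul_one] at this
  have hf0 : ∀ t ∈ Set.Icc p q, f t 0 = 0 := fun t _ => by
    simp only [hf]
    rw [clampVec_of_norm_le (by simp), Matrix.mulVec_zero]
  have hpl : IsPicardLindelof f (⟨t₀, ht₀⟩ : Set.Icc p q) x₀
      (C * R * ⟨max (q - t₀) (t₀ - p), le_max_of_le_left (by linarith [ht₀.2])⟩) 0 (C * R) C := by
    refine ⟨fun t ht => (hlip t ht).lipschitzOnWith, fun x _ => ?_, fun t ht x _ => ?_, ?_⟩
    · refine continuousOn_pi.2 fun i => ?_
      change ContinuousOn (fun t => ∑ j, A t i j * clampVec R x j) _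
      exact continuousOn_finsetSum _ fun j _ =>
        (continuousOn_entry hA i j).mul continuousOn_const
    · refine (norm_mulVec_le_sum _ _).trans ?_
      rw [NNReal.coe_mul]
      exact mul_le_mul (hC t ht) (norm_clampVec_le R.2 x) (norm_nonneg _) C.2
    · simp only [NNReal.coe_mul, NNReal.coe_zero, sub_zero]
      exact le_rfl
  obtain ⟨x, hx0, hx⟩ := hpl.exists_eq_forall_mem_Icc_hasDerivWithinAt₀
  have hx0 : x t₀ = x₀ := hx0
  have hxb : ∀ t ∈ Set.Icc p q, ‖x t‖ ≤ R := by
    intro t ht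
    have hexp : ∀ u, u ≤ q - p → ‖x₀‖ * Real.exp (C * u) ≤ R := fun u hu =>
      mul_le_mul_of_nonneg_left
        (Real.exp_le_exp.2 (mul_le_mul_of_nonneg_left hu C.2)) (norm_nonneg _)
    rcases le_total t₀ t with h | h
    · have hsub : Set.Icc t₀ q ⊆ Set.Icc p q := Set.Icc_subset_Icc_left ht₀.1
      have := norm_le_of_lipschitz_field (fun s hs => hlip s (hsub hs)) (fun s hs => hf0 s (hsub hs))
        (fun s hs => (hx s (hsub hs)).mono hsub) (t := t) ⟨h, ht.2⟩
      rw [hx0] at this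
      exact this.trans (hexp _ (by linarith [ht.2, ht₀.1]))
    · have hsub : Set.Icc p t₀ ⊆ Set.Icc p q := Set.Icc_subset_Icc_right ht₀.2
      have := norm_le_of_lipschitz_field_left (fun s hs => hlip s (hsub hs))
        (fun s hs => hf0 s (hsub hs)) (fun s hs => (hx s (hsub hs)).mono hsub) (t := t) ⟨ht.1, h⟩
      rw [hx0] at this
      exact this.trans (hexp _ (by linarith [ht.1, ht₀.2]))
  refine ⟨x, hx0, fun t ht => ?_⟩
  have ht' := Set.Ioo_subset_Icc_self ht
  have := (hx t ht').hasDerivAt (Icc_mem_nhds ht.1 ht.2)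
  simp only [hf] at this
  rwa [clampVec_of_norm_le (hxb t ht')] at this

theorem exists_Icc_subset_of_isOpen {U : Set ℝ} (hU : IsOpen U) (hU' : U.OrdConnected) {s t : ℝ}
    (hs : s ∈ U) (ht : t ∈ U) :
    ∃ p q, Set.Icc p q ⊆ U ∧ s ∈ Set.Ioo p q ∧ t ∈ Set.Ioo p q := by
  have hmin : min s t ∈ U := by rcases min_choice s t with h | h <;> rw [h] <;> assumption
  have hmax : max s t ∈ U := by rcases max_choice s t with h | h <;> rw [h] <;> assumption
  obtain ⟨ε, hε, h1⟩ := Metric.isOpen_iff.1 hU _ hmin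
  obtain ⟨δ, hδ, h2⟩ := Metric.isOpen_iff.1 hU _ hmax
  refine ⟨min s t - ε / 2, max s t + δ / 2, hU'.out (h1 ?_) (h2 ?_), ?_, ?_⟩
  · rw [Metric.mem_ball, Real.dist_eq, abs_lt]; constructor <;> linarith
  · rw [Metric.mem_ball, Real.dist_eq, abs_lt]; constructor <;> linarith
  · constructor <;> linarith [min_le_left s t, le_max_left s t]
  · constructor <;> linarith [min_le_right s t, le_max_right s t]

/-- Existence on an open interval, by joining the solutions on compact subintervals, which agree
where they overlap. -/
theorem exists_isLinearSolution {n : ℕ} {A : ℝ → Matrix (Fin n) (Fin n) ℝ} {U : Set ℝ}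
    (hU : IsOpen U) (hU' : U.OrdConnected) (hA : ContinuousOn A U) {t₀ : ℝ} (ht₀ : t₀ ∈ U)
    (x₀ : Fin n → ℝ) : ∃ x, x t₀ = x₀ ∧ IsLinearSolution A U x := by
  have H : ∀ t, ∃ (p q : ℝ) (x : ℝ → Fin n → ℝ), t ∈ U → Set.Icc p q ⊆ U ∧ t₀ ∈ Set.Ioo p q ∧
      t ∈ Set.Ioo p q ∧ x t₀ = x₀ ∧ IsLinearSolution A (Set.Ioo p q) x := by
    intro t
    by_cases ht : t ∈ U
    · obtain ⟨p, q, h1, h2, h3⟩ := exists_Icc_subset_of_isOpen hU hU' ht₀ ht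
      obtain ⟨x, h4, h5⟩ :=
        exists_isLinearSolution_Ioo (hA.mono h1) (Set.Ioo_subset_Icc_self h2) x₀
      exact ⟨p, q, x, fun _ => ⟨h1, h2, h3, h4, h5⟩⟩
    · exact ⟨0, 0, fun _ => 0, fun h => absurd h ht⟩
  choose p q x hx using H
  refine ⟨fun t => x t t, (hx t₀ ht₀).2.2.2.1, fun t ht => ?_⟩
  obtain ⟨h1, h2, h3, h4, h5⟩ := hx t ht
  refine (h5 t h3).congr_of_eventuallyEq ?_
  filter_upwards [Ioo_mem_nhds h3.1 h3.2] with s hs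
  obtain ⟨g1, g2, g3, g4, g5⟩ := hx s (h1 (Set.Ioo_subset_Icc_self hs))
  have hoc : (Set.Ioo (p t) (q t) ∩ Set.Ioo (p s) (q s)).OrdConnected :=
    Set.ordConnected_Ioo.inter Set.ordConnected_Ioo
  exact (g5.mono Set.inter_subset_right).eq_of_eq hoc
    (hA.mono fun r hr => h1 (Set.Ioo_subset_Icc_self hr.1)) (h5.mono Set.inter_subset_left)
    ⟨h2, g2⟩ ⟨hs, g3⟩ (g4.trans h4.symm)

/-! ### Covering an interval by finitely many closed sets -/

/-- If finitely many relatively closed sets cover a compact interval, then one of them contains a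
nondegenerate subinterval, by the Baire category theorem. -/
theorem exists_Icc_subset_of_cover {ι : Type*} [Finite ι] {C : ι → Set ℝ} {p q : ℝ} (hpq : p < q)
    (hcl : ∀ i, IsClosed (Set.Icc p q ∩ C i)) (hcov : ∀ t ∈ Set.Icc p q, ∃ i, t ∈ C i) :
    ∃ i p' q', p ≤ p' ∧ p' < q' ∧ q' ≤ q ∧ Set.Icc p' q' ⊆ C i := by
  let f : Option ι → Set ℝ := fun o => o.elim (Set.Iic p ∪ Set.Ici q) fun i => Set.Icc p q ∩ C i
  have hf : ∀ o, IsClosed (f o) := by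
    rintro (_ | i)
    · exact isClosed_Iic.union isClosed_Ici
    · exact hcl i
  have hU : ⋃ o, f o = Set.univ := by
    refine Set.eq_univ_of_forall fun t => Set.mem_iUnion.2 ?_
    by_cases ht : t ∈ Set.Icc p q
    · obtain ⟨i, hi⟩ := hcov t ht
      exact ⟨some i, ht, hi⟩
    · refine ⟨none, ?_⟩
      rw [Set.mem_Icc, not_and_or, not_le, not_le] at ht
      exact ht.imp le_of_lt le_of_lt
  obtain ⟨t, ht, htpq⟩ := (dense_iUnion_interior_of_closed hf hU).exists_mem_open isOpen_Ioo
    (Set.nonempty_Ioo.2 hpq)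
  obtain ⟨o, ho⟩ := Set.mem_iUnion.1 ht
  cases o with
  | none =>
    rcases interior_subset ho with h | h
    · exact absurd h (not_le.2 htpq.1)
    · exact absurd h (not_le.2 htpq.2)
  | some i =>
    obtain ⟨ε, hε, hb⟩ := Metric.isOpen_iff.1 isOpen_interior t ho
    have hsub : Set.Icc (t - ε / 2) (t + ε / 2) ⊆ Set.Icc p q ∩ C i := fun s hs =>
      interior_subset (hb (by
        rw [Metric.mem_ball, Real.dist_eq, abs_lt]
        constructor <;> linarith [hs.1, hs.2]))
    have hlt : t - ε / 2 < t + ε / 2 := by linarith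
    exact ⟨i, t - ε / 2, t + ε / 2, (hsub (Set.left_mem_Icc.2 hlt.le)).1.1, hlt,
      (hsub (Set.right_mem_Icc.2 hlt.le)).1.2, fun s hs => (hsub hs).2⟩

/-! ### Invariance of closed sets -/

theorem infDist_mulVec_le {n : ℕ} {K : Set (Fin n → ℝ)} (hK : K.Nonempty)
    {M : Matrix (Fin n) (Fin n) ℝ} (hM : ∀ y ∈ K, M *ᵥ y ∈ K) (y : Fin n → ℝ) :
    Metric.infDist (M *ᵥ y) K ≤ (1 + ∑ i, ∑ j, |(M - 1) i j|) * Metric.infDist y K := by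
  have hs : 0 ≤ ∑ i, ∑ j, |(M - 1) i j| :=
    Finset.sum_nonneg fun i _ => Finset.sum_nonneg fun j _ => abs_nonneg _
  rw [mul_comm, ← div_le_iff₀ (by linarith), Metric.le_infDist hK]
  intro k hk
  rw [div_le_iff₀ (by linarith)]
  calc Metric.infDist (M *ᵥ y) K ≤ dist (M *ᵥ y) (M *ᵥ k) := Metric.infDist_le_dist_of_mem (hM k hk)
    _ = ‖(y - k) + (M - 1) *ᵥ (y - k)‖ := by
        rw [dist_eq_norm, ← Matrix.mulVec_sub, Matrix.sub_mulVec, Matrix.one_mulVec]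
        congr 1; abel
    _ ≤ ‖y - k‖ + (∑ i, ∑ j, |(M - 1) i j|) * ‖y - k‖ :=
        (norm_add_le _ _).trans (add_le_add_right (norm_mulVec_le_sum _ _) _)
    _ = dist y k * (1 + ∑ i, ∑ j, |(M - 1) i j|) := by rw [dist_eq_norm]; ring

/-- A closed set `K` is invariant under `ẋ = A(t) x` if each `A(t)` is the derivative at `0` of a
curve of matrices `M h` through the identity that map `K` to itself for small `h > 0`: comparing
`x (t + h)` with `M h *ᵥ x t` shows that the distance to `K` grows at most exponentially. -/
theorem IsLinearSolution.mem_of_mem {n : ℕ} {A : ℝ → Matrix (Fin n) (Fin n) ℝ} {s t : ℝ}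
    (hst : s ≤ t) (hA : ContinuousOn A (Set.Icc s t)) {x : ℝ → Fin n → ℝ}
    (hx : IsLinearSolution A (Set.Icc s t) x) {K : Set (Fin n → ℝ)} (hK : IsClosed K)
    (hAK : ∀ τ ∈ Set.Icc s t, ∃ M : ℝ → Matrix (Fin n) (Fin n) ℝ, M 0 = 1 ∧
      (∀ i j, HasDerivAt (fun h => M h i j) (A τ i j) 0) ∧
      ∀ᶠ h in 𝓝[>] (0 : ℝ), ∀ y ∈ K, M h *ᵥ y ∈ K)
    (hxs : x s ∈ K) : x t ∈ K := by
  have hne : K.Nonempty := ⟨_, hxs⟩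
  obtain ⟨C, hC⟩ := exists_entry_sum_le hA
  have hgr := le_gronwallBound_of_liminf_deriv_right_le
    (f := fun τ => Metric.infDist (x τ) K) (f' := fun τ => (C + 1) * Metric.infDist (x τ) K)
    (δ := 0) (K := C + 1) (ε := 0) (a := s) (b := t)
    ((Metric.continuous_infDist_pt K).comp_continuousOn hx.continuousOn) ?_
    (by rw [Metric.infDist_zero_of_mem hxs]) (fun τ _ => by simp) t (Set.right_mem_Icc.2 hst)
  · rw [gronwallBound_ε0_δ0] at hgr
    exact (hK.mem_iff_infDist_zero hne).2 (le_antisymm hgr Metric.infDist_nonneg)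
  intro τ hτ r hr
  have hτ' := Set.Ico_subset_Icc_self hτ
  obtain ⟨M, hM0, hMd, hMK⟩ := hAK τ hτ'
  apply Eventually.frequently
  set φ := Metric.infDist (x τ) K with hφ
  have hφ0 : 0 ≤ φ := Metric.infDist_nonneg
  -- The defect of the comparison curve is `o(h)`.
  have hdef : HasDerivAt (fun z => x z - M (z - τ) *ᵥ x τ) 0 τ := by
    have h1 : HasDerivAt (fun z => M (z - τ) *ᵥ x τ) (A τ *ᵥ x τ) τ := by
      rw [hasDerivAt_pi]
      intro i
      change HasDerivAt (fun z => ∑ j, M (z - τ) i j * x τ j) (∑ j, A τ i j * x τ j) τ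
      refine HasDerivAt.fun_sum fun j _ => HasDerivAt.mul_const ?_ _
      have h0 : HasDerivAt (fun h => M h i j) (A τ i j) (τ - τ) := by rw [sub_self]; exact hMd i j
      simpa using h0.comp_sub_const τ τ
    have := (hx τ hτ').sub h1
    rw [sub_self] at this
    exact this
  have hlo : ∀ᶠ z in 𝓝[>] τ, ‖x z - M (z - τ) *ᵥ x τ‖ ≤ (r - (C + 1) * φ) / 2 * ‖z - τ‖ := by
    have := hasDerivAt_iff_isLittleO.1 hdef
    have h2 := this.def (c := (r - (C + 1) * φ) / 2) (by linarith)
    refine nhdsWithin_le_nhds (h2.mono fun z hz => ?_)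
    simpa [hM0] using hz
  have hS : ∀ᶠ h in 𝓝[>] (0 : ℝ), ∑ i, ∑ j, |(M h - 1) i j| ≤ (C + 1) * h := by
    have ht : Tendsto (fun h : ℝ => ∑ i, ∑ j, |h⁻¹ * (M h - 1) i j|) (𝓝[>] 0)
        (𝓝 (∑ i, ∑ j, |A τ i j|)) := by
      refine tendsto_finsetSum _ fun i _ => tendsto_finsetSum _ fun j _ => Tendsto.abs ?_
      have := (hMd i j).tendsto_slope_zero_right
      simpa [hM0] using this
    have hlt : ∑ i, ∑ j, |A τ i j| < C + 1 := by linarith [hC τ hτ']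
    filter_upwards [ht.eventually_lt_const hlt, self_mem_nhdsWithin] with h h1 h2
    have hpos : (0 : ℝ) < h := h2
    have e : ∑ i, ∑ j, |h⁻¹ * (M h - 1) i j| = h⁻¹ * ∑ i, ∑ j, |(M h - 1) i j| := by
      simp only [abs_mul, Finset.mul_sum, abs_of_pos (inv_pos.2 hpos)]
    rw [e, inv_mul_lt_iff₀ hpos] at h1
    linarith
  have hshift : Tendsto (fun z => z - τ) (𝓝[>] τ) (𝓝[>] 0) := by
    refine tendsto_nhdsWithin_iff.2 ⟨?_, ?_⟩
    · have : Tendsto (fun z => z - τ) (𝓝 τ) (𝓝 (τ - τ)) := Continuous.tendsto (by fun_prop) τ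
      rw [sub_self] at this
      exact this.mono_left nhdsWithin_le_nhds
    · filter_upwards [self_mem_nhdsWithin] with z hz using sub_pos.2 (Set.mem_Ioi.1 hz)
  filter_upwards [hlo, hshift.eventually hS, hshift.eventually hMK, self_mem_nhdsWithin]
    with z h1 h2 h3 h4
  have hpos : 0 < z - τ := sub_pos.2 h4
  rw [inv_mul_lt_iff₀ hpos]
  rw [Real.norm_eq_abs, abs_of_pos hpos] at h1
  have h5 : Metric.infDist (x z) K ≤
      Metric.infDist (M (z - τ) *ᵥ x τ) K + dist (x z) (M (z - τ) *ᵥ x τ) :=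
    Metric.infDist_le_infDist_add_dist
  have h6 := infDist_mulVec_le hne h3 (x τ)
  rw [dist_eq_norm] at h5
  have h7 := mul_le_mul_of_nonneg_right h2 hφ0
  nlinarith

/-! ### Evolution of the sign counts along solutions -/

theorem IsLinearSolution.mem_fewChanges {n : ℕ} [NeZero n] {A : ℝ → Matrix (Fin n) (Fin n) ℝ}
    {s t : ℝ} (hst : s ≤ t) (hA : ContinuousOn A (Set.Icc s t))
    (hQ : ∀ τ ∈ Set.Icc s t, A τ ∈ cyclicMetzlerSet n) {x : ℝ → Fin n → ℝ}
    (hx : IsLinearSolution A (Set.Icc s t) x) {m : ℕ} (hxs : x s ∈ fewChanges n m) :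
    x t ∈ fewChanges n m := by
  refine hx.mem_of_mem hst hA (isClosed_fewChanges n m) (fun τ hτ => ?_) hxs
  obtain ⟨M, h0, h1, h2⟩ := isFewChangesTangent_of_mem (hQ τ hτ)
  exact ⟨M, h0, h1, h2.mono fun h hh => hh m⟩

/-- The largest number of sign changes over all signs of the zeros does not increase either. A
pattern `τ` of `x t` becomes the only one after a small perturbation of `x t` in its direction;
the perturbed solution is then followed back to time `s`. -/
theorem IsLinearSolution.exists_cyclicChanges_ge {n : ℕ} [NeZero n]
    {A : ℝ → Matrix (Fin n) (Fin n) ℝ} {U : Set ℝ} (hU : IsOpen U) (hU' : U.OrdConnected)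
    (hA : ContinuousOn A U) (hQ : ∀ τ ∈ U, A τ ∈ cyclicMetzlerSet n) {x : ℝ → Fin n → ℝ}
    (hx : IsLinearSolution A U x) {s t : ℝ} (hs : s ∈ U) (ht : t ∈ U) (hst : s ≤ t)
    {τ : Fin n → Bool} (hτ : SignCompatible (x t) τ) :
    ∃ σ, SignCompatible (x s) σ ∧ cyclicChanges τ ≤ cyclicChanges σ := by
  obtain ⟨w, hw, hwsol⟩ :=
    exists_isLinearSolution hU hU' hA ht (fun k => if τ k = true then (1 : ℝ) else -1)
  have hev : ∀ᶠ ε : ℝ in 𝓝[>] 0, ∀ σ, SignCompatible (x s + ε • w s) σ →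
      SignCompatible (x s) σ := by
    have hc : Tendsto (fun ε : ℝ => x s + ε • w s) (𝓝 0) (𝓝 (x s + (0 : ℝ) • w s)) :=
      Continuous.tendsto (by fun_prop) 0
    rw [zero_smul, add_zero] at hc
    exact nhdsWithin_le_nhds (hc.eventually (eventually_signCompatible (x s)))
  obtain ⟨ε, hε, hpos⟩ := (hev.and self_mem_nhdsWithin).exists
  have hpos : 0 < ε := hpos
  set z := fun u => x u + ε • w u with hz
  have hsub := hU'.out hs ht
  have hzsol : IsLinearSolution A U z := hx.add_smul hwsol ε
  obtain ⟨σ, hσ⟩ : ∃ σ, SignCompatible (z s) σ :=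
    ⟨_, signCompatible_decide_pos (z s)⟩
  refine ⟨σ, hε σ hσ, ?_⟩
  obtain ⟨τ', h1, h2⟩ := (hzsol.mono hsub).mem_fewChanges hst (hA.mono hsub)
    (fun r hr => hQ r (hsub hr)) ⟨σ, hσ, le_rfl⟩
  have : τ' = τ := by
    funext k
    have hzk : z t k = x t k + ε * (if τ k = true then (1 : ℝ) else -1) := by simp [hz, hw]
    cases h : τ k
    · refine (h1 k).2 ?_
      have : x t k ≤ 0 := by
        by_contra h'
        have := (hτ k).1 (not_le.1 h')
        simp [h] at this
      rw [hzk, h]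
      simp only [Bool.false_eq_true, if_false]
      linarith
    · refine (h1 k).1 ?_
      have : 0 ≤ x t k := by
        by_contra h'
        have := (hτ k).2 (not_le.1 h')
        simp [h] at this
      rw [hzk, h]
      simp only [if_true]
      linarith
  rwa [this] at h2

theorem isReducibleMatrix_iff {n : ℕ} {M : Matrix (Fin n) (Fin n) ℝ} :
    IsReducibleMatrix M ↔ ∃ S : Finset (Fin n), S.Nonempty ∧ S ≠ Finset.univ ∧
      ∀ i ∈ S, ∀ j ∉ S, M i j = 0 := by
  constructor
  · rintro ⟨π, r, hr1, hrn, h⟩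
    refine ⟨Finset.univ.filter fun k => r ≤ (π.symm k : ℕ), ⟨π ⟨r, hrn⟩, by simp⟩, ?_, ?_⟩
    · intro hS
      have : π ⟨0, by omega⟩ ∈ Finset.univ.filter fun k => r ≤ (π.symm k : ℕ) := by
        rw [hS]; exact Finset.mem_univ _
      simp at this
      omega
    · intro i hi j hj
      simp only [Finset.mem_filter, Finset.mem_univ, true_and, not_le] at hi hj
      simpa using h (π.symm i) (π.symm j) hi hj
  · rintro ⟨S, hS, hS', h⟩
    have hcard : Fintype.card {k : Fin n // (k : ℕ) < Sᶜ.card} = Fintype.card {k // k ∈ Sᶜ} := by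
      have hle : Sᶜ.card ≤ n := by simpa using Finset.card_le_univ Sᶜ
      rw [Fintype.card_coe, Fintype.card_subtype, Fin.card_filter_val_lt, min_eq_right hle]
    let e := Fintype.equivOfCardEq hcard
    refine ⟨e.extendSubtype, Sᶜ.card, ?_, ?_, fun i j hi hj => h _ ?_ _ ?_⟩
    · rw [Nat.one_le_iff_ne_zero, Finset.card_ne_zero]
      rw [Finset.nonempty_iff_ne_empty]
      intro h0
      exact hS' (by simpa using h0)
    · have h1 := Finset.card_compl S
      have h2 := hS.card_pos
      have h3 := Finset.card_le_univ S
      rw [Fintype.card_fin] at h1 h3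
      omega
    · have := e.extendSubtype_not_mem i (by simpa using hi)
      simpa using this
    · have := e.extendSubtype_mem j hj
      simpa using this

/-- A nonzero solution has, in every interval, a time at which each zero entry sits between two
entries of opposite signs. Otherwise, on a subinterval where the set of identically vanishing
entries is maximal, the vanishing entries `k` with `x (k - 1) * x (k + 1) ≥ 0` receive no input
from the other entries, so that `A` is reducible throughout this subinterval. -/
theorem IsLinearSolution.exists_regular_time {n : ℕ} [NeZero n]
    {A : ℝ → Matrix (Fin n) (Fin n) ℝ} {U : Set ℝ} (hA : ContinuousOn A U)
    (hQ : ∀ τ ∈ U, A τ ∈ cyclicMetzlerSet n) {x : ℝ → Fin n → ℝ} (hx : IsLinearSolution A U x)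
    (hx0 : ∀ t ∈ U, x t ≠ 0) {p q : ℝ} (hpq : p < q) (hsub : Set.Icc p q ⊆ U)
    (hirr : ∀ p' q', p ≤ p' → p' < q' → q' ≤ q → ∃ t ∈ Set.Icc p' q', IsIrreducibleMatrix (A t)) :
    ∃ t ∈ Set.Icc p q, ∀ k, x t k = 0 → x t (k - 1) * x t (k + 1) < 0 := by
  by_contra! hcon
  have hxc : ∀ k, ContinuousOn (fun t => x t k) U := fun k => continuousOn_pi.1 hx.continuousOn k
  -- The sets of entries that vanish identically on some subinterval.
  let F : Set (Finset (Fin n)) := {Z | ∃ p' q', p ≤ p' ∧ p' < q' ∧ q' ≤ q ∧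
    ∀ k ∈ Z, ∀ t ∈ Set.Icc p' q', x t k = 0}
  obtain ⟨Z, hZ⟩ := F.toFinite.exists_maximal ⟨∅, p, q, le_rfl, hpq, le_rfl, by simp⟩
  obtain ⟨p', q', hp, hpq', hq, hZ0⟩ := hZ.1
  have hZmax : ∀ k ∉ Z, ∀ a b, p' ≤ a → a < b → b ≤ q' → ∃ t ∈ Set.Icc a b, x t k ≠ 0 := by
    intro k hk a b ha hab hb
    by_contra! h
    have hmem : insert k Z ∈ F := by
      refine ⟨a, b, hp.trans ha, hab, hb.trans hq, fun l hl t ht => ?_⟩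
      rcases Finset.mem_insert.1 hl with rfl | hl
      · exact h t ht
      · exact hZ0 l hl t ⟨ha.trans ht.1, ht.2.trans hb⟩
    exact hk (hZ.2 hmem (Finset.subset_insert k Z) (Finset.mem_insert_self k Z))
  have hsub' : Set.Icc p' q' ⊆ Set.Icc p q := Set.Icc_subset_Icc hp hq
  obtain ⟨k₀, p₁, q₁, hp₁, hpq₁, hq₁, hk₀⟩ := exists_Icc_subset_of_cover
    (C := fun k : Fin n => {t | x t k = 0 ∧ 0 ≤ x t (k - 1) * x t (k + 1)}) hpq' (fun k => by
      have hc := fun k => (hxc k).mono (hsub'.trans hsub)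
      exact (((hc k).prodMk ((hc (k - 1)).mul (hc (k + 1)))).preimage_isClosed_of_isClosed
        isClosed_Icc (isClosed_singleton (x := (0 : ℝ)) |>.prod isClosed_Ici)))
    (fun t ht => hcon t (hsub' ht))
  have hsub₁ : Set.Icc p₁ q₁ ⊆ Set.Icc p' q' := Set.Icc_subset_Icc hp₁ hq₁
  classical
  let S : Finset (Fin n) :=
    Z.filter fun k => ∀ t ∈ Set.Icc p₁ q₁, 0 ≤ x t (k - 1) * x t (k + 1)
  have hk₀Z : k₀ ∈ Z := by
    by_contra h
    obtain ⟨t, ht, h'⟩ := hZmax k₀ h p₁ q₁ hp₁ hpq₁ hq₁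
    exact h' (hk₀ ht).1
  have hSne : S.Nonempty := ⟨k₀, Finset.mem_filter.2 ⟨hk₀Z, fun t ht => (hk₀ ht).2⟩⟩
  have hp₁mem : p₁ ∈ Set.Icc p₁ q₁ := Set.left_mem_Icc.2 hpq₁.le
  have hSuniv : S ≠ Finset.univ := by
    intro h
    refine hx0 p₁ (hsub (hsub' (hsub₁ hp₁mem))) (funext fun k => ?_)
    have : k ∈ S := h ▸ Finset.mem_univ k
    exact hZ0 k (Finset.mem_filter.1 this).1 p₁ (hsub₁ hp₁mem)
  obtain ⟨t, ht, hit⟩ := hirr p₁ q₁ (hp.trans hp₁) hpq₁ (hq₁.trans hq)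
  refine hit (isReducibleMatrix_iff.2 ⟨S, hSne, hSuniv, fun i hi j hj => ?_⟩)
  by_contra hij
  obtain ⟨hiZ, hiprod⟩ := Finset.mem_filter.1 hi
  have hQ' := fun s (hs : s ∈ Set.Icc p₁ q₁) =>
    mem_cyclicMetzlerSet_iff.1 (hQ s (hsub (hsub' (hsub₁ hs))))
  have hne : i ≠ j := fun h => hj (h ▸ hi)
  have hnb := ((hQ' t ht).2 i j hij).resolve_left hne
  -- `j` does not vanish identically, since a neighbour of the vanishing entry `i` that did would
  -- lie in `S`.
  have hjZ : j ∉ Z := by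
    intro hjZ
    refine hj (Finset.mem_filter.2 ⟨hjZ, fun s hs => ?_⟩)
    have hxi := hZ0 i hiZ s (hsub₁ hs)
    rcases hnb with h | h
    · have : j - 1 = i := by rw [h]; simp
      rw [this, hxi, zero_mul]
    · rw [← h, hxi, mul_zero]
  have hAc : ContinuousOn (fun s => A s i j) (Set.Icc p₁ q₁) :=
    (continuousOn_entry hA i j).mono ((hsub₁.trans hsub').trans hsub)
  have hev : ∀ᶠ s in 𝓝[Set.Icc p₁ q₁] t, A s i j ≠ 0 := (hAc t ht).eventually_ne hij
  obtain ⟨ε, hε, hball⟩ := Metric.mem_nhdsWithin_iff.1 hev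
  obtain ⟨a, b, ha, hab, hb, hne0⟩ : ∃ a b, p₁ < a ∧ a < b ∧ b < q₁ ∧
      ∀ s ∈ Set.Icc a b, A s i j ≠ 0 := by
    have h1 : max p₁ (t - ε) < min q₁ (t + ε) := by
      rw [max_lt_iff, lt_min_iff, lt_min_iff]
      refine ⟨⟨hpq₁, ?_⟩, ?_, ?_⟩ <;> linarith [ht.1, ht.2]
    obtain ⟨a, ha1, ha2⟩ := exists_between h1
    obtain ⟨b, hb1, hb2⟩ := exists_between ha2
    rw [max_lt_iff] at ha1
    rw [lt_min_iff] at hb2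
    refine ⟨a, b, ha1.1, hb1, hb2.1, fun s hs => hball ⟨?_, ?_, ?_⟩⟩
    · rw [Metric.mem_ball, Real.dist_eq, abs_lt]
      constructor <;> linarith [hs.1, hs.2, ha1.2, hb2.2]
    · linarith [hs.1, ha1.1]
    · linarith [hs.2, hb2.1]
  obtain ⟨s, hs, hxs⟩ := hZmax j hjZ a b (hp₁.trans ha.le) hab (hb.le.trans hq₁)
  have hsI : s ∈ Set.Icc p₁ q₁ := ⟨ha.le.trans hs.1, hs.2.trans hb.le⟩
  have hzero : ∑ l, A s i l * x s l = 0 := by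
    have h1 : HasDerivAt (fun r => x r i) (∑ l, A s i l * x s l) s :=
      hasDerivAt_pi.1 (hx s (hsub (hsub' (hsub₁ hsI)))) i
    have h2 : HasDerivAt (fun r => x r i) 0 s := by
      refine (hasDerivAt_const s (0 : ℝ)).congr_of_eventuallyEq ?_
      filter_upwards [Icc_mem_nhds (ha.trans_le hs.1) (hs.2.trans_lt hb)] with r hr
      exact hZ0 i hiZ r (hsub₁ hr)
    exact h1.unique h2
  -- All the inputs into entry `i` have the sign of `x s j` or vanish.
  have hterm : ∀ l ∈ Finset.univ, 0 ≤ A s i l * x s l * x s j := by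
    intro l _
    by_cases hl : A s i l = 0
    · simp [hl]
    by_cases hil : i = l
    · rw [← hil, hZ0 i hiZ s (hsub₁ hsI)]; simp
    have hA0 := (hQ' s hsI).1 i l hil
    rw [mul_assoc]
    refine mul_nonneg hA0 ?_
    have hpr := hiprod s hsI
    have e : ∀ l : Fin n, i = l + 1 → l = i - 1 := fun l h => by rw [h]; simp
    rcases ((hQ' s hsI).2 i l hl).resolve_left hil with h | h <;> rcases hnb with h' | h'
    · rw [h, h']; exact mul_self_nonneg _
    · rw [h, e j h', mul_comm]; exact hpr
    · rw [e l h, h']; exact hpr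
    · rw [e l h, e j h']; exact mul_self_nonneg _
  have hsum : ∑ l, A s i l * x s l * x s j = 0 := by rw [← Finset.sum_mul, hzero, zero_mul]
  have := (Finset.sum_eq_zero_iff_of_nonneg hterm).1 hsum j (Finset.mem_univ j)
  rw [mul_assoc] at this
  exact (mul_ne_zero (hne0 s hs) (mul_self_ne_zero.2 hxs)) this

/-! ### Transition matrices -/

theorem isOpen_setOf_ereal_between (a b : EReal) :
    IsOpen {t : ℝ | a < (t : EReal) ∧ (t : EReal) < b} :=
  (isOpen_Ioo (a := a) (b := b)).preimage continuous_coe_real_ereal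

theorem ordConnected_setOf_ereal_between (a b : EReal) :
    {t : ℝ | a < (t : EReal) ∧ (t : EReal) < b}.OrdConnected :=
  ⟨fun _ hs _ ht _ hr => ⟨hs.1.trans_le (EReal.coe_le_coe_iff.2 hr.1),
    (EReal.coe_le_coe_iff.2 hr.2).trans_lt ht.2⟩⟩

theorem exists_isTransitionMatrix {n : ℕ} {a b : EReal} {A : ℝ → Matrix (Fin n) (Fin n) ℝ}
    (hA : ContinuousOn A {t : ℝ | a < (t : EReal) ∧ (t : EReal) < b}) :
    ∃ Φ, IsTransitionMatrix a b A Φ := by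
  set U := {t : ℝ | a < (t : EReal) ∧ (t : EReal) < b}
  have H : ∀ (t₀ : ℝ) (j : Fin n), ∃ x : ℝ → Fin n → ℝ, t₀ ∈ U →
      x t₀ = Pi.single j 1 ∧ IsLinearSolution A U x := by
    intro t₀ j
    by_cases h : t₀ ∈ U
    · obtain ⟨x, hx⟩ := exists_isLinearSolution (isOpen_setOf_ereal_between a b)
        (ordConnected_setOf_ereal_between a b) hA h (Pi.single j 1)
      exact ⟨x, fun _ => hx⟩
    · exact ⟨fun _ => 0, fun h' => absurd h' h⟩
  choose x hx using H
  refine ⟨fun t t₀ => Matrix.of fun i j => x t₀ j t i, fun t₀ h1 h2 => ⟨?_, fun t ht1 ht2 i j => ?_⟩⟩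
  · ext i j
    change x t₀ j t₀ i = _
    rw [(hx t₀ j ⟨h1, h2⟩).1, Matrix.one_apply, Pi.single_apply]
  · exact hasDerivAt_pi.1 ((hx t₀ j ⟨h1, h2⟩).2 t ⟨ht1, ht2⟩) i

theorem IsTransitionMatrix.isLinearSolution {n : ℕ} {a b : EReal}
    {A : ℝ → Matrix (Fin n) (Fin n) ℝ} {Φ : ℝ → ℝ → Matrix (Fin n) (Fin n) ℝ}
    (h : IsTransitionMatrix a b A Φ) {t₀ : ℝ} (h1 : a < t₀) (h2 : t₀ < b) (v : Fin n → ℝ) :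
    IsLinearSolution A {t : ℝ | a < (t : EReal) ∧ (t : EReal) < b} (fun t => Φ t t₀ *ᵥ v) := by
  intro t ht
  rw [Matrix.mulVec_mulVec, hasDerivAt_pi]
  intro i
  change HasDerivAt (fun s => ∑ j, Φ s t₀ i j * v j) (∑ j, (A t * Φ t t₀) i j * v j) t
  exact HasDerivAt.fun_sum fun j _ => ((h t₀ h1 h2).2 t ht.1 ht.2 i j).mul_const (v j)

theorem isCVDDS_of_mem_of_irreducible {n : ℕ} [NeZero n] {a b : EReal}
    {A : ℝ → Matrix (Fin n) (Fin n) ℝ}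
    (hA : ContinuousOn A {t : ℝ | a < (t : EReal) ∧ (t : EReal) < b})
    (hQ : ∀ s : ℝ, a < (s : EReal) → (s : EReal) < b → A s ∈ cyclicMetzlerSet n)
    (hirr : ∀ p q : ℝ, a < (p : EReal) → p < q → (q : EReal) < b →
      ∃ t : ℝ, t ∈ Set.Icc p q ∧ IsIrreducibleMatrix (A t)) : IsCVDDS a b A := by
  have hU := isOpen_setOf_ereal_between a b
  have hU' := ordConnected_setOf_ereal_between a b
  have hQ' : ∀ s ∈ {t : ℝ | a < (t : EReal) ∧ (t : EReal) < b}, A s ∈ cyclicMetzlerSet n :=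
    fun s hs => hQ s hs.1 hs.2
  obtain ⟨Φ, hΦ⟩ := exists_isTransitionMatrix hA
  refine ⟨Φ, hΦ, fun t₀ t ha hlt hb v hv => ?_⟩
  have hlt' := EReal.coe_lt_coe_iff.2 hlt
  have ht₀ : t₀ ∈ {t : ℝ | a < (t : EReal) ∧ (t : EReal) < b} := ⟨ha, hlt'.trans hb⟩
  have ht : t ∈ {t : ℝ | a < (t : EReal) ∧ (t : EReal) < b} := ⟨ha.trans hlt', hb⟩
  have hsub := hU'.out ht₀ ht
  have hx := hΦ.isLinearSolution ha (hlt'.trans hb) v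
  set x := fun t => Φ t t₀ *ᵥ v with hxdef
  have hxt₀ : x t₀ = v := by simp [hxdef, (hΦ t₀ ha (hlt'.trans hb)).1]
  have hx0 : ∀ s ∈ {t : ℝ | a < (t : EReal) ∧ (t : EReal) < b}, x s ≠ 0 := fun s hs h0 =>
    hv (hxt₀ ▸ hx.eq_zero hU' hA hs ht₀ h0)
  obtain ⟨s, hs, hreg⟩ := hx.exists_regular_time hA hQ' hx0 hlt hsub fun p' q' h1 h2 h3 =>
    hirr p' q' (ha.trans_le (EReal.coe_le_coe_iff.2 h1)) h2
      ((EReal.coe_le_coe_iff.2 h3).trans_lt hb)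
  refine cyclicSignVarPlus_le fun σ hσ => ?_
  obtain ⟨σ₁, hσ₁, hle₁⟩ := hx.exists_cyclicChanges_ge hU hU' hA hQ' (hsub hs) ht hs.2 hσ
  obtain ⟨σ₀, hσ₀, hle₀⟩ := exists_cyclicChanges_le hv
  have hsub' : Set.Icc t₀ s ⊆ {t : ℝ | a < (t : EReal) ∧ (t : EReal) < b} :=
    hU'.out ht₀ (hsub hs)
  obtain ⟨σ₂, hσ₂, hle₂⟩ := (hx.mono hsub').mem_fewChanges hs.1 (hA.mono hsub')
    (fun r hr => hQ' r (hsub' hr)) (m := cyclicChanges σ₀) ⟨σ₀, by rwa [hxt₀], le_rfl⟩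
  rw [cyclicChanges_eq_of_regular hreg hσ₁ hσ₂] at hle₁
  exact hle₁.trans (hle₂.trans hle₀)

/-! ### Necessity of the conditions -/

theorem eq_of_cyclicChanges_eq_zero {n : ℕ} [NeZero n] {σ : Fin n → Bool}
    (h : cyclicChanges σ = 0) (k : Fin n) : σ k = σ 0 := by
  have hstep : ∀ k, σ (k + 1) = σ k := by
    intro k
    have := Finset.sum_eq_zero_iff.1 h k (Finset.mem_univ k)
    by_contra hne
    simp [Ne.symm hne] at this
  have : ∀ m : ℕ, σ (Fin.ofNat n m) = σ 0 := by
    intro m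
    induction m with
    | zero => rfl
    | succ m ih =>
      have e : Fin.ofNat n (m + 1) = Fin.ofNat n m + 1 := by
        ext; simp [Fin.val_add]
      rw [e, hstep, ih]
  have e : Fin.ofNat n (k : ℕ) = k := by ext; simp
  rw [← e]
  exact this k

theorem add_one_ne_self {n : ℕ} [NeZero n] {i j : Fin n} (hij : i ≠ j) (k : Fin n) : k + 1 ≠ k := by
  intro h
  have h1 : (1 : Fin n) = 0 := by simpa using h
  have hi := congrArg (fun u => i * u) h1
  have hj := congrArg (fun u => j * u) h1
  simp only [mul_one, mul_zero] at hi hj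
  exact hij (hi.trans hj.symm)

/-- A vector without sign changes, however its zeros are filled, has entries of one strict sign. -/
theorem pos_of_cyclicSignVarPlus_eq_zero {n : ℕ} [NeZero n] {i j : Fin n} (hij : i ≠ j)
    {y : Fin n → ℝ} (hy : cyclicSignVarPlus y = 0) : (∀ k, 0 < y k) ∨ (∀ k, y k < 0) := by
  have hconst : ∀ σ, SignCompatible y σ → ∀ k, σ k = σ 0 := fun σ hσ =>
    eq_of_cyclicChanges_eq_zero (Nat.le_zero.1 (hy ▸ le_cyclicSignVarPlus hσ))
  have hσ := signCompatible_decide_pos y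
  have hne : ∀ k, y k ≠ 0 := by
    intro k hk
    have hσ' : SignCompatible y (Function.update (fun k => decide (0 < y k)) k true) := by
      intro l
      by_cases hl : l = k
      · subst hl; simp [hk]
      · simpa [hl] using hσ l
    have h1 := (hconst _ hσ' k).trans (hconst _ hσ' (k + 1)).symm
    have h2 := (hconst _ hσ k).trans (hconst _ hσ (k + 1)).symm
    rw [Function.update_self, Function.update_of_ne (add_one_ne_self hij k)] at h1
    rw [← h1] at h2
    simp [hk] at h2
  by_cases h0 : 0 < y 0
  · left
    intro k
    have := hconst _ hσ k
    simpa [h0] using this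
  · right
    intro k
    have := hconst _ hσ k
    simp only [h0, decide_false, decide_eq_false_iff_not, not_lt] at this
    exact lt_of_le_of_ne this (hne k)

/-- Nonnegative nonzero vectors have no sign changes, so that the transition matrices of a cyclic
variation diminishing system are positive. The indices `i₀ ≠ j₀` express that `n ≥ 2`. -/
theorem transitionMatrix_pos {n : ℕ} [NeZero n] {a b : EReal} {A : ℝ → Matrix (Fin n) (Fin n) ℝ}
    {Φ : ℝ → ℝ → Matrix (Fin n) (Fin n) ℝ} (hΦ : IsTransitionMatrix a b A Φ)
    (hV : ∀ t₀ t : ℝ, a < t₀ → t₀ < t → t < b → StrongCyclicVDP (Φ t t₀))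
    {i₀ j₀ : Fin n} (hij : i₀ ≠ j₀) {t₀ t : ℝ} (ha : a < t₀) (hlt : t₀ < t) (hb : t < b)
    (i j : Fin n) : 0 < Φ t t₀ i j := by
  have hlt' := EReal.coe_lt_coe_iff.2 hlt
  have hsign : ∀ s, t₀ < s → s ≤ t → (∀ k, 0 < Φ s t₀ k j) ∨ (∀ k, Φ s t₀ k j < 0) := by
    intro s h1 h2
    have hsb : (s : EReal) < b := (EReal.coe_le_coe_iff.2 h2).trans_lt hb
    have h0 : cyclicSignVarMinus (Pi.single j 1 : Fin n → ℝ) ≤ 0 := by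
      have hc : SignCompatible (Pi.single j 1 : Fin n → ℝ) fun _ => true := by
        intro k
        by_cases hk : k = j
        · subst hk; simp
        · simp [hk]
      have := cyclicSignVarMinus_le hc
      simpa [cyclicChanges] using this
    have h3 := hV t₀ s ha h1 hsb (Pi.single j 1) (by simp)
    have := pos_of_cyclicSignVarPlus_eq_zero hij (Nat.le_zero.1 (h3.trans h0))
    simpa using this
  refine (hsign t hlt le_rfl).elim (fun h => h i) fun hneg => ?_
  exfalso
  have hc : ContinuousOn (fun s => Φ s t₀ j j) (Set.Icc t₀ t) := fun s hs =>
    ((hΦ t₀ ha (hlt'.trans hb)).2 s (ha.trans_le (EReal.coe_le_coe_iff.2 hs.1))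
      ((EReal.coe_le_coe_iff.2 hs.2).trans_lt hb) j j).continuousAt.continuousWithinAt
  have h1 : Φ t₀ t₀ j j = 1 := by rw [(hΦ t₀ ha (hlt'.trans hb)).1]; simp
  obtain ⟨s, hs, hs0⟩ := intermediate_value_Icc' hlt.le hc
    (show (0 : ℝ) ∈ Set.Icc (Φ t t₀ j j) (Φ t₀ t₀ j j) from ⟨(hneg j).le, by rw [h1]; norm_num⟩)
  have hs0 : Φ s t₀ j j = 0 := hs0
  have hne : t₀ ≠ s := by
    rintro rfl
    rw [h1] at hs0
    norm_num at hs0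
  rcases hsign s (lt_of_le_of_ne hs.1 hne) hs.2 with h | h
  · exact (h j).ne' hs0
  · exact (h j).ne hs0

theorem eventually_nhdsGT_mem_ereal {b : EReal} {t : ℝ} (ht : t < b) :
    ∀ᶠ s : ℝ in 𝓝[>] t, t < s ∧ (s : EReal) < b := by
  have : ∀ᶠ s : ℝ in 𝓝 t, (s : EReal) < b :=
    (continuous_coe_real_ereal.tendsto t).eventually_lt_const ht
  filter_upwards [self_mem_nhdsWithin, nhdsWithin_le_nhds this] with s h1 h2 using ⟨h1, h2⟩

theorem isMetzler_of_isCVDDS {n : ℕ} [NeZero n] {a b : EReal} {A : ℝ → Matrix (Fin n) (Fin n) ℝ}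
    {Φ : ℝ → ℝ → Matrix (Fin n) (Fin n) ℝ} (hΦ : IsTransitionMatrix a b A Φ)
    (hV : ∀ t₀ t : ℝ, a < t₀ → t₀ < t → t < b → StrongCyclicVDP (Φ t t₀)) {t : ℝ} (ha : a < t)
    (hb : t < b) {i j : Fin n} (hij : i ≠ j) : 0 ≤ A t i j := by
  have hd := (hΦ t ha hb).2 t ha hb i j
  have h1 := (hΦ t ha hb).1
  rw [h1, mul_one] at hd
  refine ge_of_tendsto hd.tendsto_slope_zero_right ?_
  have hsh : Tendsto (fun h : ℝ => t + h) (𝓝[>] 0) (𝓝[>] t) := by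
    refine tendsto_nhdsWithin_iff.2 ⟨?_, ?_⟩
    · have : Tendsto (fun h : ℝ => t + h) (𝓝 0) (𝓝 (t + 0)) := Continuous.tendsto (by fun_prop) 0
      rw [add_zero] at this
      exact this.mono_left nhdsWithin_le_nhds
    · filter_upwards [self_mem_nhdsWithin] with h hh using lt_add_of_pos_right t hh
  filter_upwards [hsh.eventually (eventually_nhdsGT_mem_ereal hb), self_mem_nhdsWithin]
    with h hh hpos
  have h2 := transitionMatrix_pos hΦ hV hij ha hh.1 hh.2 i j
  rw [h1, Matrix.one_apply_ne hij, sub_zero, smul_eq_mul]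
  exact mul_nonneg (inv_nonneg.2 (le_of_lt hpos)) h2.le

/-- A positive entry between `i` and `j` that are not neighbours on the ring would let a very
negative entry `j` push a zero entry `i` with positive neighbours below zero, which creates two
more sign changes. -/
theorem eq_zero_of_isCVDDS {n : ℕ} [NeZero n] {a b : EReal} {A : ℝ → Matrix (Fin n) (Fin n) ℝ}
    {Φ : ℝ → ℝ → Matrix (Fin n) (Fin n) ℝ} (hΦ : IsTransitionMatrix a b A Φ)
    (hV : ∀ t₀ t : ℝ, a < t₀ → t₀ < t → t < b → StrongCyclicVDP (Φ t t₀)) {t : ℝ} (ha : a < t)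
    (hb : t < b) {i j : Fin n} (hij : i ≠ j) (h1 : j ≠ i + 1) (h2 : i ≠ j + 1) : A t i j = 0 := by
  by_contra h0
  have hpos : 0 < A t i j := lt_of_le_of_ne (isMetzler_of_isCVDDS hΦ hV ha hb hij) (Ne.symm h0)
  set c := ∑ l, |A t i l| with hc
  have hc0 : 0 ≤ c := Finset.sum_nonneg fun l _ => abs_nonneg _
  set K := (c + 1) / A t i j with hK
  have hK0 : 0 < K := by positivity
  have hKA : A t i j * K = c + 1 := by rw [hK]; field_simp
  let v : Fin n → ℝ := fun l => if l = i then 0 else if l = j then -K else 1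
  have hvj : v j = -K := by simp [v, hij.symm]
  have hvi : v i = 0 := by simp [v]
  have hvl : ∀ l, l ≠ i → l ≠ j → v l = 1 := fun l h h' => by simp [v, h, h']
  have hsol := hΦ.isLinearSolution ha hb v
  have hyt : Φ t t *ᵥ v = v := by rw [(hΦ t ha hb).1, Matrix.one_mulVec]
  have hAv : (A t *ᵥ v) i < 0 := by
    have hle : ∀ l ∈ Finset.univ, A t i l * v l ≤ |A t i l| - if l = j then A t i l * K else 0 := by
      intro l _
      by_cases hli : l = i
      · subst hli; simp [hvi, hij]
      by_cases hlj : l = j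
      · subst hlj; rw [hvj, if_pos rfl]; linarith [abs_nonneg (A t i l)]
      · rw [hvl l hli hlj, if_neg hlj, mul_one, sub_zero]; exact le_abs_self _
    have hs := Finset.sum_le_sum hle
    rw [Finset.sum_sub_distrib, Finset.sum_ite_eq' Finset.univ j, if_pos (Finset.mem_univ j),
      hKA] at hs
    change ∑ l, A t i l * v l < 0
    linarith
  have hd : HasDerivAt (fun s => (Φ s t *ᵥ v) i) ((A t *ᵥ v) i) t := by
    have := hasDerivAt_pi.1 (hsol t ⟨ha, hb⟩) i
    simpa only [hyt] using this
  have hneg : ∀ᶠ s in 𝓝[>] t, (Φ s t *ᵥ v) i < 0 := by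
    have hs := (hasDerivAt_iff_tendsto_slope.1 hd).mono_left
      (nhdsWithin_mono t (fun s (hs : t < s) => hs.ne'))
    filter_upwards [hs.eventually_lt_const hAv, self_mem_nhdsWithin] with s h3 h4
    rw [slope_def_field, hyt, hvi, sub_zero] at h3
    exact (div_neg_iff.1 h3).resolve_left (fun h => absurd h.2 (sub_pos.2 h4).not_gt) |>.1
  have hcont : Tendsto (fun s => Φ s t *ᵥ v) (𝓝[>] t) (𝓝 v) := by
    have := (hsol t ⟨ha, hb⟩).continuousAt.tendsto
    rw [hyt] at this
    exact this.mono_left nhdsWithin_le_nhds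
  obtain ⟨s, hcomp, hsi, hts, hsb⟩ := ((hcont.eventually (eventually_signs_eq v)).and
    (hneg.and (eventually_nhdsGT_mem_ereal hb))).exists
  have hv0 : v ≠ 0 := fun h => by
    have := congrFun h j
    rw [hvj, Pi.zero_apply] at this
    linarith
  let σ₀ : Fin n → Bool := fun l => decide (l ≠ j)
  have hσ₀ : SignCompatible v σ₀ := by
    intro l
    by_cases hlj : l = j
    · subst hlj; rw [hvj]; simp [σ₀, hK0.le]
    · by_cases hli : l = i
      · subst hli; simp [hvi]
      · rw [hvl l hli hlj]; simp [σ₀, hlj]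
  have hσ : SignCompatible (Φ s t *ᵥ v) (Function.update σ₀ i false) := by
    intro l
    by_cases hli : l = i
    · subst hli; simp [hsi.le, hsi]
    · rw [Function.update_of_ne hli]
      by_cases hlj : l = j
      · subst hlj
        have := (hcomp l).2 (by rw [hvj]; linarith)
        simp [σ₀, this.le]
      · have := (hcomp l).1 (by rw [hvl l hli hlj]; norm_num)
        simp [σ₀, hlj, this.le]
  have hle := (le_cyclicSignVarPlus hσ).trans
    ((hV t s ha hts hsb v hv0).trans (cyclicSignVarMinus_le hσ₀))
  have hi1 : i - 1 ≠ i := fun h => add_one_ne_self hij i (by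
    rw [sub_eq_iff_eq_add] at h; exact h.symm)
  have hup := cyclicChanges_update hi1 σ₀ false
  have e1 : σ₀ (i - 1) = true := by
    simp only [σ₀, decide_eq_true_eq]
    rintro h
    exact h2 (by rw [← h]; simp)
  have e2 : σ₀ i = true := by simp [σ₀, hij]
  have e3 : σ₀ (i + 1) = true := by simp [σ₀, Ne.symm h1]
  rw [e1, e2, e3] at hup
  simp at hup
  omega

/-- If a block `A i j`, `i ∈ S`, `j ∉ S`, vanishes on an interval, then the entries in `S` of the
solution that starts at a unit vector `e j` with `j ∉ S` solve a closed linear system and stay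
zero, which contradicts positivity. -/
theorem exists_irreducible_of_isCVDDS {n : ℕ} [NeZero n] {a b : EReal}
    {A : ℝ → Matrix (Fin n) (Fin n) ℝ}
    (hA : ContinuousOn A {t : ℝ | a < (t : EReal) ∧ (t : EReal) < b})
    {Φ : ℝ → ℝ → Matrix (Fin n) (Fin n) ℝ} (hΦ : IsTransitionMatrix a b A Φ)
    (hV : ∀ t₀ t : ℝ, a < t₀ → t₀ < t → t < b → StrongCyclicVDP (Φ t t₀)) {p q : ℝ} (ha : a < p)
    (hpq : p < q) (hb : q < b) : ∃ t ∈ Set.Icc p q, IsIrreducibleMatrix (A t) := by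
  by_contra! hcon
  have hsub : Set.Icc p q ⊆ {t : ℝ | a < (t : EReal) ∧ (t : EReal) < b} := fun t ht =>
    ⟨ha.trans_le (EReal.coe_le_coe_iff.2 ht.1), (EReal.coe_le_coe_iff.2 ht.2).trans_lt hb⟩
  obtain ⟨⟨S, hS, hS'⟩, p', q', hp, hpq', hq, hzero⟩ := exists_Icc_subset_of_cover
    (ι := {S : Finset (Fin n) // S.Nonempty ∧ S ≠ Finset.univ})
    (C := fun S => {t | ∀ i ∈ S.1, ∀ j ∉ S.1, A t i j = 0}) hpq (fun S => by
      have : Set.Icc p q ∩ {t | ∀ i ∈ S.1, ∀ j ∉ S.1, A t i j = 0} =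
          Set.Icc p q ∩ A ⁻¹' {M | ∀ i ∈ S.1, ∀ j ∉ S.1, M i j = 0} := rfl
      rw [this]
      refine (hA.mono hsub).preimage_isClosed_of_isClosed isClosed_Icc ?_
      simp only [Set.ofPred_forall]
      refine isClosed_iInter fun i => isClosed_iInter fun _ => isClosed_iInter fun j =>
        isClosed_iInter fun _ => ?_
      exact isClosed_eq ((continuous_apply j).comp (continuous_apply i)) continuous_const)
    (fun t ht => by
      obtain ⟨S, h1, h2, h3⟩ := isReducibleMatrix_iff.1 (not_not.1 (hcon t ht))
      exact ⟨⟨S, h1, h2⟩, h3⟩)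
  obtain ⟨i, hi⟩ := hS
  obtain ⟨j, hj⟩ : ∃ j, j ∉ S := by
    by_contra! h
    exact hS' (Finset.eq_univ_of_forall h)
  have hij : i ≠ j := fun h => hj (h ▸ hi)
  have hsub' : Set.Icc p' q' ⊆ {t : ℝ | a < (t : EReal) ∧ (t : EReal) < b} :=
    (Set.Icc_subset_Icc hp hq).trans hsub
  have hp' := hsub' (Set.left_mem_Icc.2 hpq'.le)
  have hq' := hsub' (Set.right_mem_Icc.2 hpq'.le)
  have hsol := hΦ.isLinearSolution hp'.1 hp'.2 (Pi.single j 1)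
  have hpos := transitionMatrix_pos hΦ hV hij hp'.1 hpq' hq'.2 i j
  let B : ℝ → Matrix (Fin n) (Fin n) ℝ := fun t k l => if k ∈ S ∧ l ∈ S then A t k l else 0
  let u : ℝ → Fin n → ℝ := fun t k => if k ∈ S then (Φ t p' *ᵥ Pi.single j 1) k else 0
  have hB : ContinuousOn B (Set.Icc p' q') := by
    refine continuousOn_pi.2 fun k => continuousOn_pi.2 fun l => ?_
    by_cases h : k ∈ S ∧ l ∈ S
    · simpa only [B, if_pos h] using (continuousOn_entry hA k l).mono hsub'
    · simpa only [B, if_neg h] using continuousOn_const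
  have hu : IsLinearSolution B (Set.Icc p' q') u := by
    intro t ht
    rw [hasDerivAt_pi]
    intro k
    by_cases hk : k ∈ S
    · have h1 := hasDerivAt_pi.1 (hsol t (hsub' ht)) k
      have e : (B t *ᵥ u t) k = (A t *ᵥ (Φ t p' *ᵥ Pi.single j 1)) k := by
        change ∑ l, B t k l * u t l = ∑ l, A t k l * (Φ t p' *ᵥ Pi.single j 1) l
        refine Finset.sum_congr rfl fun l _ => ?_
        by_cases hl : l ∈ S
        · simp only [B, u, hk, hl, and_self, if_true]
        · rw [hzero ht k hk l hl]; simp [B, hl]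
      rw [e]
      simpa only [u, if_pos hk] using h1
    · have e : (B t *ᵥ u t) k = 0 := by
        change ∑ l, B t k l * u t l = 0
        exact Finset.sum_eq_zero fun l _ => by simp [B, hk]
      rw [e]
      simpa only [u, if_neg hk] using hasDerivAt_const t (0 : ℝ)
  have hup : u p' = 0 := by
    funext k
    by_cases hk : k ∈ S
    · have hkj : k ≠ j := fun h => hj (h ▸ hk)
      simp [u, (hΦ p' hp'.1 hp'.2).1, hkj]
    · simp [u, hk]
  have huq := hu.eq_zero Set.ordConnected_Icc hB (Set.left_mem_Icc.2 hpq'.le)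
    (Set.right_mem_Icc.2 hpq'.le) hup
  have := congrFun huq i
  simp only [u, if_pos hi, Pi.zero_apply, Matrix.mulVec_single_one, Matrix.col_apply] at this
  exact hpos.ne' this

theorem theorem5 (n : ℕ) (hn : 1 ≤ n) (a b : EReal) (hab : a < b)
    (A : ℝ → Matrix (Fin n) (Fin n) ℝ)
    (hA : ContinuousOn A {t : ℝ | a < (t : EReal) ∧ (t : EReal) < b}) :
    ((∀ s : ℝ, a < (s : EReal) → (s : EReal) < b → A s ∈ cyclicMetzlerSet n) ∧
      (∀ p q : ℝ, a < (p : EReal) → p < q → (q : EReal) < b →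
        ∃ t : ℝ, t ∈ Set.Icc p q ∧ IsIrreducibleMatrix (A t))) ↔
    IsCVDDS a b A := by
  have : NeZero n := ⟨by omega⟩
  constructor
  · rintro ⟨hQ, hirr⟩
    exact isCVDDS_of_mem_of_irreducible hA hQ hirr
  · rintro ⟨Φ, hΦ, hV⟩
    refine ⟨fun s h1 h2 => mem_cyclicMetzlerSet_iff.2
      ⟨fun i j hij => isMetzler_of_isCVDDS hΦ hV h1 h2 hij, fun i j h0 => ?_⟩,
      fun p q h1 h2 h3 => exists_irreducible_of_isCVDDS hA hΦ hV h1 h2 h3⟩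
    by_contra! h
    exact h0 (eq_zero_of_isCVDDS hΦ hV h1 h2 h.1 h.2.1 h.2.2)
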